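/- A bipartite graph $G=(V_1\cup V_2,E)$ has finite vertex classes $V_1=\{1,\dots,m\}$, $V_2=\{1,\dots,n\}$ and edges $E\subseteq V_1\times V_2$. A $k$-matching of $G$ is a set of exactly $k$ edges of $G$, no two distinct ones of which have a common vertex; $\phi(k,G)$ is the number of $k$-matchings of $G$ (so $\phi(0,G)=1$). Graphs are given to Turing machines by their $(0,1)$ adjacency matrices (with $m$, $n$ and $k$ written in unary), and computed numbers are written in binary. A counting problem $P$ (a set of instances encoded injectively as words over a finite alphabet, with a number $P(x)\in\mathbb N$ to be computed for each instance $x$) is *polynomially reducible* to a counting problem $Q$ if there are a map $f$ from instances of $P$ to instances of $Q$ and a function $g$ with natural-number values, both computable by (multi-stack) Turing machines in time polynomial in the length of the input, such that $P(x)=g\bigl(x,\,Q(f(x))\bigr)$ for every instance $x$ of $P$. Two counting problems are *polynomially equivalent* if each is polynomially reducible to the other. **Proposition.** Let $c,\alpha\in(0,1]$. The problem of computing $\phi(k,G)$ for inputs $(G,k)$, where $G=(V_1\cup V_2,E)$ is a bipartite graph with $$\min(\#V_1,\#V_2)\ \ge\ k\ \ge\ c\,\max(\#V_1,\#V_2)^{\alpha},$$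 is polynomially equivalent to the problem of computing the number of perfect matchings $\phi(\#V_1',G')$ of a bipartite graph $G'=(V_1'\cup V_2',E')$ with $\#V_1'=\#V_2'$. Moreover, for fixed $c,\alpha$, the length of an input $(G,k)$ of the first problem is at most a polynomial in $k$, so that time polynomial in the input length is also time polynomial in $k$. -/

import Mathlib

/-- A finite bipartite graph with vertex classes `V₁ = Fin m`, `V₂ = Fin n` and edge set
`E ⊆ V₁ × V₂`. -/
structure BipGraph where
  m : ℕ
  n : ℕ
  E : Finset (Fin m × Fin n)

namespace BipGraph

/-- A set of edges is a matching if no two distinct edges in it have a common vertex. -/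
abbrev IsMatching {m n : ℕ} (M : Finset (Fin m × Fin n)) : Prop :=
  ∀ e ∈ M, ∀ e' ∈ M, e ≠ e' → e.1 ≠ e'.1 ∧ e.2 ≠ e'.2

/-- The number of `k`-matchings of `G`: sets of exactly `k` edges of `G` that are matchings. -/
def numMatchings (G : BipGraph) (k : ℕ) : ℕ :=
  ((G.E.powersetCard k).filter fun M => IsMatching M).card

/-- The adjacency-matrix encoding over the alphabet `{0, 1, #}`, where `some false`, `some true`
and `none` are `0`, `1` and `#`:  `1^m # 1^n #` followed by the `m` rows of the `(0,1)` matrix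
of the graph, each row terminated by `#`. -/
def encode (G : BipGraph) : List (Option Bool) :=
  List.replicate G.m (some true) ++ none ::
    (List.replicate G.n (some true) ++ none ::
      (List.ofFn fun i : Fin G.m =>
        (List.ofFn fun j : Fin G.n => some (decide ((i, j) ∈ G.E))) ++ [none]).flatten)

end BipGraph

theorem replicate_sep_inj {a b : ℕ} {l l' : List (Option Bool)}
    (h : List.replicate a (some true) ++ none :: l = List.replicate b (some true) ++ none :: l') :
    a = b ∧ l = l' := by
  induction a generalizing b with
  | zero => cases b <;> simp_all [List.replicate_succ]
  | succ a ih =>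
    cases b with
    | zero => simp [List.replicate_succ] at h
    | succ b =>
      simp only [List.replicate_succ, List.cons_append, List.cons.injEq, true_and] at h
      have := ih h
      exact ⟨by omega, this.2⟩

theorem BipGraph.encode_injective : Function.Injective BipGraph.encode := by
  rintro ⟨m, n, E⟩ ⟨m', n', E'⟩ h
  obtain ⟨rfl, h⟩ := replicate_sep_inj h
  obtain ⟨rfl, h⟩ := replicate_sep_inj h
  have h2 := List.eq_iff_flatten_eq.2 ⟨h, by simp [List.map_ofFn, Function.comp_def]⟩
  have h3 := List.ofFn_injective h2
  congr 1
  ext ⟨i, j⟩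
  have h4 := congrFun h3 i
  have h5 := congrFun (List.ofFn_injective (List.append_cancel_right h4)) j
  simpa using h5

/-- A (promise) counting problem: a set of instances, each encoded without ambiguity as a word over
a finite alphabet, and the natural number to be computed for each instance. -/
structure CountingProblem where
  Inst : Type
  Γ : Type
  [finΓ : Fintype Γ]
  encode : Inst → List Γ
  encode_injective : Function.Injective encode
  count : Inst → ℕ

/-- The input word formed by an instance of `P` followed by the binary digits (least significant
first) of a number, the two parts being written over disjoint alphabets. -/
def CountingProblem.encodeWithNat (P : CountingProblem) (p : P.Inst × ℕ) : List (P.Γ ⊕ Bool) :=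
  (P.encode p.1).map Sum.inl ++ (Nat.bits p.2).map Sum.inr

/-- Polynomial-time reducibility of counting problems, with a single oracle call: in time polynomial
in the length of the input, a Turing machine transforms each instance `x` of `P` into an
instance `f x` of `Q`, and another one computes, from `x` and the answer `Q.count (f x)` written
in binary, the number `P.count x` in binary. -/
def CountingProblem.PolyReducible (P Q : CountingProblem) : Prop :=
  ∃ (f : P.Inst → Q.Inst) (g : P.Inst × ℕ → ℕ),
    Nonempty (Turing.TM2ComputableInPolyTime P.encode Q.encode f) ∧
    Nonempty (Turing.TM2ComputableInPolyTime P.encodeWithNat Nat.bits g) ∧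
    ∀ x : P.Inst, P.count x = g (x, Q.count (f x))

/-- Polynomial equivalence: reducibility in polynomial time in both directions. -/
def CountingProblem.PolyEquivalent (P Q : CountingProblem) : Prop :=
  P.PolyReducible Q ∧ Q.PolyReducible P

/-- Counting the `k`-matchings of a bipartite graph `G`, for inputs `(G, k)` with
`min(#V₁, #V₂) ≥ k ≥ c max(#V₁, #V₂)^α`. The input word is `1^k #` followed by the encoding
of `G`. -/
def kMatchingProblem (c α : ℝ) : CountingProblem where
  Inst := {x : BipGraph × ℕ //
    x.2 ≤ min x.1.m x.1.n ∧ c * ((max x.1.m x.1.n : ℕ) : ℝ) ^ α ≤ (x.2 : ℝ)}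
  Γ := Option Bool
  encode x := List.replicate x.1.2 (some true) ++ none :: x.1.1.encode
  encode_injective := by
    rintro ⟨⟨G, k⟩, hx⟩ ⟨⟨G', k'⟩, hx'⟩ h
    obtain ⟨h1, h2⟩ := replicate_sep_inj h
    simp only at h1 h2
    exact Subtype.ext (Prod.ext (BipGraph.encode_injective h2) h1)
  count x := x.1.1.numMatchings x.1.2

/-- Counting the perfect matchings of a bipartite graph with `#V₁ = #V₂`; with `2n` vertices,
these are the `n`-matchings. -/
def perfectMatchingProblem : CountingProblem where
  Inst := {G : BipGraph // G.m = G.n}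
  Γ := Option Bool
  encode G := G.1.encode
  encode_injective := fun _ _ h => Subtype.ext (BipGraph.encode_injective h)
  count G := G.1.numMatchings G.1.n

/-!
The two reductions rest on a padding construction. Given a bipartite graph `G` with classes of
sizes `m` and `n`, and `k ≤ min m n`, add `n - k` vertices to `V₁`, adjacent to all of the old `V₂`,
and `m - k` vertices to `V₂`, adjacent to all of the old `V₁`. The new graph has equal classes. In
a perfect matching of it all new vertices are matched with old ones, so that exactly `k` edges lie
between old vertices; these form a `k`-matching of `G`, and every `k`-matching arises from
`(n - k)! * (m - k)!` perfect matchings (`card_extensions`, `BipGraph.numMatchings_pad`). Hence the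
number of `k`-matchings is the number of perfect matchings of the padded graph divided by
`(n - k)! * (m - k)!`. In the other direction, counting the perfect matchings of `G` is counting its
`n`-matchings, and `(G, n)` is an admissible input as `c * n ^ α ≤ n`.

That the maps involved are computable in polynomial time is shown by programs in a small structured
language of stack operations (`StackProg`), which is compiled to Mathlib's multi-stack machines;
one step of a program is one step of the machine (`StackProg.Run.simulate`). The padded graph is
written down directly (`Exec.padGraph`). The factorials are divided out one factor at a time: each
factor is at most the input length and is kept in unary, so long division of the binary answer,
digit by digit, takes polynomial time (`Exec.divDigit`, `Exec.divideFactorial`, `Exec.unpad`).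

The bound on the input length holds since `k ≥ c * max m n ^ α` gives `max m n ≤ (k / c) ^ (1 / α)`.
-/

/-! ### A structured language for stack machines -/

/-- Structured programs acting on finitely many stacks. `pop k c` removes the top of stack `k` and
continues with `c` applied to it; `loop k p c` repeatedly removes the top `a` of stack `k`, runs
`c a` as long as `p a` holds, and ends (having removed `a`) when `p a` fails or the stack is
empty. -/
inductive StackProg {K : Type} (Γ : K → Type) : Type
  | skip : StackProg Γ
  | push (k : K) (a : Γ k) : StackProg Γ
  | seq (c d : StackProg Γ) : StackProg Γ
  | pop (k : K) (c : Option (Γ k) → StackProg Γ) : StackProg Γ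
  | loop (k : K) (p : Γ k → Bool) (c : Γ k → StackProg Γ) : StackProg Γ

namespace StackProg

open Turing Function

variable {K : Type} {Γ : K → Type}

/-- The control points of a program: a position inside a branch of `pop` or a body of `loop` also
records which symbol the branch or body belongs to. -/
def Label : StackProg Γ → Type
  | skip => Unit
  | push _ _ => Unit
  | seq c d => c.Label ⊕ d.Label
  | pop k c => Option (Σ o : Option (Γ k), (c o).Label)
  | loop k _ c => Option (Σ a : Γ k, (c a).Label)

theorem finite_label [∀ k, Finite (Γ k)] (c : StackProg Γ) : Finite c.Label := by
  induction c with
  | skip => exact inferInstanceAs (Finite Unit)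
  | push => exact inferInstanceAs (Finite Unit)
  | seq c d hc hd => exact inferInstanceAs (Finite (c.Label ⊕ d.Label))
  | pop k c hc => exact inferInstanceAs (Finite (Option (Σ o : Option (Γ k), (c o).Label)))
  | loop k p c hc => exact inferInstanceAs (Finite (Option (Σ a : Γ k, (c a).Label)))

/-- The control point at which a program starts. -/
def entry : (c : StackProg Γ) → c.Label
  | skip => ()
  | push _ _ => ()
  | seq c _ => Sum.inl c.entry
  | pop _ _ => none
  | loop _ _ _ => none

variable [DecidableEq K]

/-- The registers of the compiled machine: for each stack, the symbol removed from it last. -/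
abbrev Reg (Γ : K → Type) : Type := ∀ k, Option (Γ k)

/-- The machine statements at the control points of a program, when these are placed among the
labels `Λ` of a machine by `e` and control is to pass to `x` at the end. -/
def code {Λ : Type} :
    (c : StackProg Γ) → (c.Label → Λ) → Λ → c.Label → TM2.Stmt Γ Λ (Reg Γ)
  | skip, _, x, _ => .goto fun _ => x
  | push k a, _, x, _ => .push k (fun _ => a) (.goto fun _ => x)
  | seq c d, e, _, .inl l => c.code (fun l => e (.inl l)) (e (.inr d.entry)) l
  | seq _ d, e, x, .inr l => d.code (fun l => e (.inr l)) x l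
  | pop k c, e, _, none =>
    .pop k (fun v o => update v k o) (.goto fun v => e (some ⟨v k, (c (v k)).entry⟩))
  | pop _ c, e, x, some ⟨o, l⟩ => (c o).code (fun l => e (some ⟨o, l⟩)) x l
  | loop k p c, e, x, none =>
    .pop k (fun v o => update v k o) (.goto fun v =>
      match v k with
      | none => x
      | some a => if p a then e (some ⟨a, (c a).entry⟩) else x)
  | loop _ _ c, e, _, some ⟨a, l⟩ => (c a).code (fun l => e (some ⟨a, l⟩)) (e none) l

/-- `Run c S t S'`: started with stack contents `S`, the program `c` ends after `t` steps with
stack contents `S'`. -/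
inductive Run : StackProg Γ → (∀ k, List (Γ k)) → ℕ → (∀ k, List (Γ k)) → Prop
  | skip (S) : Run skip S 1 S
  | push (S) (k : K) (a : Γ k) : Run (push k a) S 1 (update S k (a :: S k))
  | seq {c d : StackProg Γ} {S S' S'' t t'} (h : Run c S t S') (h' : Run d S' t' S'') :
      Run (seq c d) S (t + t') S''
  | pop {k : K} {c : Option (Γ k) → StackProg Γ} {S S' t}
      (h : Run (c (S k).head?) (update S k (S k).tail) t S') : Run (pop k c) S (1 + t) S'
  | loop_nil {k : K} {p : Γ k → Bool} {c : Γ k → StackProg Γ} {S} (hS : S k = []) :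
      Run (loop k p c) S 1 S
  | loop_exit {k : K} {p : Γ k → Bool} {c : Γ k → StackProg Γ} {S a l} (hS : S k = a :: l)
      (hp : p a = false) : Run (loop k p c) S 1 (update S k l)
  | loop_step {k : K} {p : Γ k → Bool} {c : Γ k → StackProg Γ} {S S' S'' a l t t'}
      (hS : S k = a :: l) (hp : p a = true) (h : Run (c a) (update S k l) t S')
      (h' : Run (loop k p c) S' t' S'') : Run (loop k p c) S (1 + (t + t')) S''

/-- A machine containing the code of a program simulates its runs step by step. -/
theorem Run.simulate {Λ : Type} {M : Λ → TM2.Stmt Γ Λ (Reg Γ)} {c : StackProg Γ}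
    {S S' : ∀ k, List (Γ k)} {t : ℕ} (h : Run c S t S') :
    ∀ (e : c.Label → Λ) (x : Λ), (∀ l, M (e l) = c.code e x l) → ∀ v, ∃ v',
      (flip bind (TM2.step M))^[t] (some ⟨some (e c.entry), v, S⟩) = some ⟨some x, v', S'⟩ := by
  induction h with
  | skip S =>
    intro e x hM v
    refine ⟨v, ?_⟩
    have h0 := hM ()
    simp only [code] at h0
    simp [flip, entry, h0]
  | push S k a =>
    intro e x hM v
    refine ⟨v, ?_⟩
    have h0 := hM ()
    simp only [code] at h0
    simp [flip, entry, h0]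
  | seq h h' ih ih' =>
    intro e x hM v
    obtain ⟨v', hv'⟩ := ih (fun l => e (.inl l)) _ (fun l => hM (.inl l)) v
    obtain ⟨v'', hv''⟩ := ih' (fun l => e (.inr l)) x (fun l => hM (.inr l)) v'
    refine ⟨v'', ?_⟩
    rw [add_comm, iterate_add_apply]
    exact (congrArg _ hv').trans hv''
  | @pop k c S S' t h ih =>
    intro e x hM v
    obtain ⟨v', hv'⟩ := ih (fun l => e (some ⟨_, l⟩)) x (fun l => hM (some ⟨_, l⟩))
      (update v k (S k).head?)
    refine ⟨v', ?_⟩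
    rw [add_comm, iterate_add_apply, ← hv']
    congr 1
    have h0 := hM none
    simp only [code] at h0
    have h1 : ∀ o, o = (S k).head? → e (some ⟨o, (c o).entry⟩) =
        e (some ⟨(S k).head?, (c (S k).head?).entry⟩) := by rintro _ rfl; rfl
    simp [flip, entry, h0, h1 _ (update_self k (S k).head? v)]
  | @loop_nil k p c S hS =>
    intro e x hM v
    refine ⟨update v k none, ?_⟩
    have h0 := hM none
    simp only [code] at h0
    have h1 : update S k [] = S := by rw [← hS]; exact update_eq_self k S
    simp [flip, entry, h0, hS, h1]
  | @loop_exit k p c S a l hS hp =>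
    intro e x hM v
    refine ⟨update v k (some a), ?_⟩
    have h0 := hM none
    simp only [code] at h0
    simp [flip, entry, h0, hS, hp]
  | @loop_step k p c S S' S'' a l t t' hS hp h h' ih ih' =>
    intro e x hM v
    obtain ⟨v', hv'⟩ := ih (fun l => e (some ⟨_, l⟩)) (e none) (fun l => hM (some ⟨_, l⟩))
      (update v k (some a))
    obtain ⟨v'', hv''⟩ := ih' e x hM v'
    refine ⟨v'', ?_⟩
    rw [add_comm, iterate_add_apply, add_comm t, iterate_add_apply, ← hv'']
    congr 1
    simp only [entry] at hv' ⊢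
    rw [← hv']
    congr 1
    have h0 := hM none
    simp only [code] at h0
    simp [flip, h0, hS, hp]

/-- A program, followed by a step that clears the registers and halts, as a machine. The label
`none` is that of the last step; the registers are cleared because the final configuration of a
`FinTM2` is required to carry the initial state. -/
noncomputable def toFinTM2 [Fintype K] [∀ k, Fintype (Γ k)] (c : StackProg Γ) (k₀ k₁ : K) :
    FinTM2 where
  K := K
  k₀ := k₀
  k₁ := k₁
  Γ := Γ
  Λ := Option c.Label
  main := some c.entry
  ΛFin := haveI := c.finite_label; Fintype.ofFinite _
  σ := Reg Γ
  initialState := fun _ => none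
  m := fun
    | none => .load (fun _ _ => none) .halt
    | some l => c.code some none l

/-- The stack contents in `Turing.initList` and `Turing.haltList`, in terms of `Function.update`. -/
theorem update_nil_apply (k₀ : K) (w : List (Γ k₀)) (k : K) :
    (if h : k = k₀ then (by rw [h]; exact w : List (Γ k)) else []) =
      update (fun _ => []) k₀ w k := by
  by_cases hk : k = k₀
  · subst hk; simp
  · simp [hk]

/-- A function is computable in polynomial time if it is computed by a program within a polynomial
number of steps. -/
theorem polyTime_of_run [Fintype K] [∀ k, Fintype (Γ k)] (c : StackProg Γ) (k₀ k₁ : K)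
    {α β : Type} {ea : α → List (Γ k₀)} {eb : β → List (Γ k₁)} {f : α → β} (p : Polynomial ℕ)
    (h : ∀ a, ∃ t ≤ p.eval (ea a).length,
      Run c (update (fun _ => []) k₀ (ea a)) t (update (fun _ => []) k₁ (eb (f a)))) :
    Nonempty (TM2ComputableInPolyTime ea eb f) := by
  have key : ∀ a, Nonempty (TM2OutputsInTime (c.toFinTM2 k₀ k₁)
      (List.map (Equiv.refl (Γ k₀)).invFun (ea a))
      (some (List.map (Equiv.refl (Γ k₁)).invFun (eb (f a)))) ((p + 1).eval (ea a).length)) := by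
    intro a
    obtain ⟨t, ht, hr⟩ := h a
    obtain ⟨v', hv'⟩ := hr.simulate (M := (c.toFinTM2 k₀ k₁).m) some none (fun _ => rfl)
      (fun _ => none)
    refine ⟨⟨⟨t + 1, ?_⟩, by simpa using ht⟩⟩
    have e0 : initList (c.toFinTM2 k₀ k₁) (List.map (Equiv.refl (Γ k₀)).invFun (ea a)) =
        ⟨some (some c.entry), fun _ => none, update (fun _ => []) k₀ (ea a)⟩ := by
      simp only [initList, toFinTM2]
      congr 1
      funext k
      have hm : List.map (Equiv.refl (Γ k₀)).invFun (ea a) = ea a := List.map_id _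
      rw [hm]
      exact update_nil_apply k₀ (ea a) k
    have e1 : haltList (c.toFinTM2 k₀ k₁) (List.map (Equiv.refl (Γ k₁)).invFun (eb (f a))) =
        ⟨none, fun _ => none, update (fun _ => []) k₁ (eb (f a))⟩ := by
      simp only [haltList, toFinTM2]
      congr 1
      funext k
      have hm : List.map (Equiv.refl (Γ k₁)).invFun (eb (f a)) = eb (f a) := List.map_id _
      rw [hm]
      exact update_nil_apply k₁ (eb (f a)) k
    rw [e0, Option.map_some, e1, add_comm, iterate_add_apply]
    refine (congrArg _ hv').trans ?_
    rfl
  exact ⟨{ tm := c.toFinTM2 k₀ k₁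
           inputAlphabet := Equiv.refl _
           outputAlphabet := Equiv.refl _
           time := p + 1
           outputsFun := fun a => (key a).some }⟩

end StackProg

/-! ### Memories and time-bounded execution -/

open Function StackProg

/-- The unary counters used by the programs. The counters `k₁`, `k₂`, `m`, `n`, `p`, `q` hold two
copies of `k`, the class sizes `m` and `n`, and the numbers `m - k` and `n - k` of new vertices;
`e` holds the remainder of a division, and `t`, `u`, `v`, `f` are working memory. -/
inductive Counter
  | k₁ | k₂ | m | n | p | q | t | u | v | e | f
  deriving DecidableEq

instance : Fintype Counter :=
  ⟨{.k₁, .k₂, .m, .n, .p, .q, .t, .u, .v, .e, .f}, fun c => by cases c <;> decide⟩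

/-- The stacks used by the programs: input, output, two buffers and the unary counters. -/
inductive Stk
  | inp | out | buf₁ | buf₂ | cnt (c : Counter)
  deriving DecidableEq, Fintype

/-- The stack alphabets, for input alphabet `α`, output alphabet `β` and buffer alphabet `γ`. -/
abbrev Alph (α β γ : Type) : Stk → Type
  | .inp => α
  | .out => β
  | .buf₁ => γ
  | .buf₂ => γ
  | .cnt _ => Unit

instance Alph.fintype {α β γ : Type} [Fintype α] [Fintype β] [Fintype γ] :
    ∀ k, Fintype (Alph α β γ k)
  | .inp => inferInstanceAs (Fintype α)
  | .out => inferInstanceAs (Fintype β)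
  | .buf₁ => inferInstanceAs (Fintype γ)
  | .buf₂ => inferInstanceAs (Fintype γ)
  | .cnt _ => inferInstanceAs (Fintype Unit)

/-- The contents of all stacks, each counter being given by its value. -/
@[ext] structure Mem (α β γ : Type) where
  inp : List α
  out : List β
  buf₁ : List γ
  buf₂ : List γ
  cnt : Counter → ℕ

variable {α β γ : Type}

namespace Mem

/-- The stack contents described by a memory; a counter of value `i` is a stack of height `i`. -/
def stk (s : Mem α β γ) : ∀ k, List (Alph α β γ k)
  | .inp => s.inp
  | .out => s.out
  | .buf₁ => s.buf₁
  | .buf₂ => s.buf₂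
  | .cnt c => List.replicate (s.cnt c) ()

theorem update_inp (s : Mem α β γ) (l : List α) :
    update s.stk .inp l = stk { s with inp := l } := by
  funext k; cases k <;> simp [stk, update]

theorem update_out (s : Mem α β γ) (l : List β) :
    update s.stk .out l = stk { s with out := l } := by
  funext k; cases k <;> simp [stk, update]

theorem update_buf₁ (s : Mem α β γ) (l : List γ) :
    update s.stk .buf₁ l = stk { s with buf₁ := l } := by
  funext k; cases k <;> simp [stk, update]

theorem update_buf₂ (s : Mem α β γ) (l : List γ) :
    update s.stk .buf₂ l = stk { s with buf₂ := l } := by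
  funext k; cases k <;> simp [stk, update]

theorem update_cnt (s : Mem α β γ) (c : Counter) (i : ℕ) :
    update s.stk (.cnt c) (List.replicate i ()) = stk { s with cnt := update s.cnt c i } := by
  funext k
  cases k with
  | cnt d =>
    by_cases h : d = c
    · subst h; simp [stk]
    · simp [stk, h]
  | _ => simp [stk, update]

end Mem

/-- Programs on the stacks `Stk`. -/
abbrev Prog (α β γ : Type) : Type := StackProg (Alph α β γ)

/-- The program `c` transforms the memory `s` into `s'` within at most `n` steps. -/
def Exec (c : Prog α β γ) (s : Mem α β γ) (n : ℕ) (s' : Mem α β γ) : Prop :=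
  ∃ t ≤ n, Run c s.stk t s'.stk

/-- Sequential composition of programs. -/
infixr:60 " ;; " => StackProg.seq

namespace Prog

/-- Increase a counter. -/
def inc (c : Counter) : Prog α β γ := push (.cnt c) ()

/-- Write a symbol to the output. -/
def writeOut (a : β) : Prog α β γ := push .out a

/-- Write a symbol to the first buffer. -/
def write₁ (a : γ) : Prog α β γ := push .buf₁ a

/-- Write a symbol to the second buffer. -/
def write₂ (a : γ) : Prog α β γ := push .buf₂ a

/-- Run `x` if the counter is zero; otherwise decrease it and run `y`. -/
def dec (c : Counter) (x y : Prog α β γ) : Prog α β γ :=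
  pop (.cnt c) fun o => if o.isSome then y else x

/-- Decrease a counter to zero, running `x` after each decrement. -/
def forCnt (c : Counter) (x : Prog α β γ) : Prog α β γ :=
  loop (.cnt c) (fun _ => true) fun _ => x

/-- Read the input up to and including the first symbol that violates `p`, running `x` on each
symbol before that. -/
def readWhile (p : α → Bool) (x : α → Prog α β γ) : Prog α β γ := loop .inp p x

/-- Read the remaining input, running `x` on each symbol. -/
def readAll (x : α → Prog α β γ) : Prog α β γ := readWhile (fun _ => true) x

/-- Empty the first buffer, running `x` on each symbol. -/
def forBuf₁ (x : γ → Prog α β γ) : Prog α β γ := loop .buf₁ (fun _ => true) x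

/-- Empty the second buffer, running `x` on each symbol. -/
def forBuf₂ (x : γ → Prog α β γ) : Prog α β γ := loop .buf₂ (fun _ => true) x

end Prog

open Prog

namespace Exec

variable {s s' s'' : Mem α β γ} {n n' : ℕ} {c d : Prog α β γ}

theorem weaken (h : Exec c s n s') (hs : s' = s'') (hn : n ≤ n') : Exec c s n' s'' := by
  obtain ⟨t, ht, hr⟩ := h
  exact ⟨t, ht.trans hn, hs ▸ hr⟩

theorem seq (h : Exec c s n s') (h' : Exec d s' n' s'') : Exec (c ;; d) s (n + n') s'' := by
  obtain ⟨t, ht, hr⟩ := h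
  obtain ⟨t', ht', hr'⟩ := h'
  exact ⟨t + t', by omega, .seq hr hr'⟩

theorem skip (s : Mem α β γ) : Exec StackProg.skip s 1 s := ⟨1, le_rfl, .skip _⟩

theorem inc (s : Mem α β γ) (c : Counter) :
    Exec (inc c) s 1 { s with cnt := update s.cnt c (s.cnt c + 1) } := by
  refine ⟨1, le_rfl, ?_⟩
  rw [← Mem.update_cnt, List.replicate_succ]
  exact .push _ _ _

theorem writeOut (s : Mem α β γ) (a : β) :
    Exec (writeOut a) s 1 { s with out := a :: s.out } := by
  refine ⟨1, le_rfl, ?_⟩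
  rw [← Mem.update_out s (a :: s.out)]
  exact .push s.stk .out a

theorem write₁ (s : Mem α β γ) (a : γ) :
    Exec (write₁ a) s 1 { s with buf₁ := a :: s.buf₁ } := by
  refine ⟨1, le_rfl, ?_⟩
  rw [← Mem.update_buf₁ s (a :: s.buf₁)]
  exact .push s.stk .buf₁ a

theorem write₂ (s : Mem α β γ) (a : γ) :
    Exec (write₂ a) s 1 { s with buf₂ := a :: s.buf₂ } := by
  refine ⟨1, le_rfl, ?_⟩
  rw [← Mem.update_buf₂ s (a :: s.buf₂)]
  exact .push s.stk .buf₂ a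

theorem dec_zero {i : Counter} (hi : s.cnt i = 0) (h : Exec c s n s') :
    Exec (dec i c d) s (1 + n) s' := by
  obtain ⟨t, ht, hr⟩ := h
  refine ⟨1 + t, by omega, .pop ?_⟩
  have h0 : s.stk (.cnt i) = [] := by simp [Mem.stk, hi]
  have h1 : update s.stk (.cnt i) [] = s.stk := by rw [← h0]; exact update_eq_self _ _
  simpa [h0, h1] using hr

theorem dec_succ {i : Counter} {j : ℕ} (hi : s.cnt i = j + 1)
    (h : Exec d { s with cnt := update s.cnt i j } n s') : Exec (dec i c d) s (1 + n) s' := by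
  obtain ⟨t, ht, hr⟩ := h
  refine ⟨1 + t, by omega, .pop ?_⟩
  have h0 : s.stk (.cnt i) = () :: List.replicate j () := by
    simp [Mem.stk, hi, List.replicate_succ]
  rw [← Mem.update_cnt] at hr
  simpa [h0] using hr

theorem popOut_nil {x : Option β → Prog α β γ} (hs : s.out = []) (h : Exec (x none) s n s') :
    Exec (pop .out x) s (1 + n) s' := by
  obtain ⟨t, ht, hr⟩ := h
  refine ⟨1 + t, by omega, .pop ?_⟩
  have h0 : s.stk .out = [] := hs
  have h1 : update s.stk .out [] = s.stk := by rw [← h0]; exact update_eq_self _ _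
  simpa [h0, h1] using hr

theorem popOut_cons {x : Option β → Prog α β γ} {a : β} {l : List β} (hs : s.out = a :: l)
    (h : Exec (x (some a)) { s with out := l } n s') : Exec (pop .out x) s (1 + n) s' := by
  obtain ⟨t, ht, hr⟩ := h
  refine ⟨1 + t, by omega, .pop ?_⟩
  have h0 : s.stk .out = a :: l := hs
  simpa [h0, Mem.update_out] using hr

theorem forCnt_zero {i : Counter} (hi : s.cnt i = 0) : Exec (forCnt i c) s 1 s :=
  ⟨1, le_rfl, .loop_nil (by simp [Mem.stk, hi])⟩

theorem forCnt_succ {i : Counter} {j : ℕ} (hi : s.cnt i = j + 1)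
    (h : Exec c { s with cnt := update s.cnt i j } n s') (h' : Exec (forCnt i c) s' n' s'') :
    Exec (forCnt i c) s (1 + (n + n')) s'' := by
  obtain ⟨t, ht, hr⟩ := h
  obtain ⟨t', ht', hr'⟩ := h'
  rw [← Mem.update_cnt] at hr
  exact ⟨1 + (t + t'), by omega, .loop_step (a := ()) (l := List.replicate j ())
    (by simp [Mem.stk, hi, List.replicate_succ]) rfl hr hr'⟩

theorem readWhile_nil {p : α → Bool} {x : α → Prog α β γ} (hs : s.inp = []) :
    Exec (readWhile p x) s 1 s :=
  ⟨1, le_rfl, .loop_nil hs⟩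

theorem readWhile_exit {p : α → Bool} {x : α → Prog α β γ} {a : α} {l : List α}
    (hs : s.inp = a :: l) (hp : p a = false) :
    Exec (readWhile p x) s 1 { s with inp := l } := by
  refine ⟨1, le_rfl, ?_⟩
  rw [← Mem.update_inp s l]
  exact .loop_exit hs hp

theorem readWhile_step {p : α → Bool} {x : α → Prog α β γ} {a : α} {l : List α}
    (hs : s.inp = a :: l) (hp : p a = true) (h : Exec (x a) { s with inp := l } n s')
    (h' : Exec (readWhile p x) s' n' s'') : Exec (readWhile p x) s (1 + (n + n')) s'' := by
  obtain ⟨t, ht, hr⟩ := h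
  obtain ⟨t', ht', hr'⟩ := h'
  rw [← Mem.update_inp] at hr
  exact ⟨1 + (t + t'), by omega, .loop_step hs hp hr hr'⟩

theorem forBuf₁_nil {x : γ → Prog α β γ} (hs : s.buf₁ = []) : Exec (forBuf₁ x) s 1 s :=
  ⟨1, le_rfl, .loop_nil hs⟩

theorem forBuf₁_cons {x : γ → Prog α β γ} {a : γ} {l : List γ}
    (hs : s.buf₁ = a :: l) (h : Exec (x a) { s with buf₁ := l } n s')
    (h' : Exec (forBuf₁ x) s' n' s'') : Exec (forBuf₁ x) s (1 + (n + n')) s'' := by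
  obtain ⟨t, ht, hr⟩ := h
  obtain ⟨t', ht', hr'⟩ := h'
  rw [← Mem.update_buf₁] at hr
  exact ⟨1 + (t + t'), by omega, .loop_step hs rfl hr hr'⟩

theorem forBuf₂_nil {x : γ → Prog α β γ} (hs : s.buf₂ = []) : Exec (forBuf₂ x) s 1 s :=
  ⟨1, le_rfl, .loop_nil hs⟩

theorem forBuf₂_cons {x : γ → Prog α β γ} {a : γ} {l : List γ}
    (hs : s.buf₂ = a :: l) (h : Exec (x a) { s with buf₂ := l } n s')
    (h' : Exec (forBuf₂ x) s' n' s'') : Exec (forBuf₂ x) s (1 + (n + n')) s'' := by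
  obtain ⟨t, ht, hr⟩ := h
  obtain ⟨t', ht', hr'⟩ := h'
  rw [← Mem.update_buf₂] at hr
  exact ⟨1 + (t + t'), by omega, .loop_step hs rfl hr hr'⟩

end Exec

/-- A function is computable in polynomial time if some program transforms its input into its
output, with all other stacks empty, within a polynomial number of steps. -/
theorem polyTime_of_exec [Fintype α] [Fintype β] [Fintype γ] {X Y : Type} {ea : X → List α}
    {eb : Y → List β} {f : X → Y} (c : Prog α β γ) (p : Polynomial ℕ)
    (h : ∀ a, Exec c ⟨ea a, [], [], [], 0⟩ (p.eval (ea a).length) ⟨[], eb (f a), [], [], 0⟩) :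
    Nonempty (Turing.TM2ComputableInPolyTime ea eb f) := by
  refine StackProg.polyTime_of_run (ea := ea) (eb := eb) c .inp .out p fun a => ?_
  have h0 : (⟨ea a, [], [], [], 0⟩ : Mem α β γ).stk =
        update (β := fun k => List (Alph α β γ k)) (fun _ => []) .inp (ea a) := by
    funext k; cases k <;> simp [Mem.stk, update]
  have h1 : (⟨[], eb (f a), [], [], 0⟩ : Mem α β γ).stk =
      update (β := fun k => List (Alph α β γ k)) (fun _ => []) .out (eb (f a)) := by
    funext k; cases k <;> simp [Mem.stk, update]
  rw [← h0, ← h1]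
  exact h a

/-! ### Programs for counters and for the graph sizes -/

namespace Prog

/-- Set a counter to zero. -/
def clear (i : Counter) : Prog α β γ := forCnt i skip

/-- Add the counter `i` to the counter `j`, setting `i` to zero. -/
def move (i j : Counter) : Prog α β γ := forCnt i (inc j)

/-- Write as many copies of `a` to the first buffer as the counter `i` says, keeping `i`. -/
def emit (i : Counter) (a : γ) : Prog α β γ :=
  forCnt i (write₁ a ;; inc .t) ;; move .t i

/-- For an input that starts with three blocks `1^k # 1^m # 1^n #`, where `one` tells `1` from `#`:
read these, and set the counters `m`, `n`, `p`, `q` to `m`, `n`, `m - k`, `n - k`. While the second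
block is read, the copy `k₁` of `k` is counted down, and `p` up once it has reached zero; likewise
for the third block. -/
def readDims (one : α → Bool) : Prog α β γ :=
  readWhile one (fun _ => inc .k₁ ;; inc .k₂) ;;
  readWhile one (fun _ => inc .m ;; dec .k₁ (inc .p) skip) ;;
  readWhile one (fun _ => inc .n ;; dec .k₂ (inc .q) skip)

end Prog

namespace Exec

theorem clear {s : Mem α β γ} {i : Counter} {n : ℕ} (hi : s.cnt i = n) :
    Exec (clear i) s (2 * n + 1) { s with cnt := update s.cnt i 0 } := by
  induction n generalizing s with
  | zero => exact (forCnt_zero hi).weaken (by rw [← hi, update_eq_self]) (by omega)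
  | succ n ih =>
    refine (forCnt_succ hi (skip _) (ih ?_)).weaken ?_ (by omega)
    · simp
    · simp

theorem move {s : Mem α β γ} {i j : Counter} (hij : i ≠ j) {n : ℕ} (hi : s.cnt i = n) :
    Exec (move i j) s (2 * n + 1)
      { s with cnt := update (update s.cnt i 0) j (s.cnt j + n) } := by
  induction n generalizing s with
  | zero =>
    refine (forCnt_zero hi).weaken ?_ (by omega)
    rw [← hi, update_eq_self, hi, add_zero, update_eq_self]
  | succ n ih =>
    refine (forCnt_succ hi (inc _ _) (ih ?_)).weaken ?_ (by omega)
    · simp [hij]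
    · ext x <;> simp [update_apply]
      grind

theorem emit {s : Mem α β γ} {i : Counter} (hi : i ≠ .t) (ht : s.cnt .t = 0) (a : γ) :
    Exec (emit i a) s (5 * s.cnt i + 2)
      { s with buf₁ := List.replicate (s.cnt i) a ++ s.buf₁ } := by
  have key : ∀ (n : ℕ) (s : Mem α β γ), s.cnt i = n →
      Exec (forCnt i (Prog.write₁ a ;; Prog.inc .t)) s (3 * n + 1)
        { s with
          buf₁ := List.replicate n a ++ s.buf₁
          cnt := update (update s.cnt i 0) .t (s.cnt .t + n) } := by
    intro n
    induction n with
    | zero =>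
      intro s hs
      refine (forCnt_zero hs).weaken ?_ (by omega)
      rw [← hs, update_eq_self, hs, add_zero, update_eq_self]
      simp
    | succ n ih =>
      intro s hs
      refine (forCnt_succ hs ((write₁ _ a).seq (inc _ _)) (ih _ ?_)).weaken ?_ (by omega)
      · simp [hi]
      · ext x
        · rfl
        · rfl
        · simp [List.replicate_succ']
        · rfl
        · simp [update_apply]; grind
  refine ((key _ s rfl).seq (move (Ne.symm hi) (n := s.cnt i) ?_)).weaken ?_ (by omega)
  · simp [ht]
  · ext x <;> simp [update_apply]
    grind

theorem readDims {one : α → Bool} {o z : α} (ho : one o = true) (hz : one z = false)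
    {k m n : ℕ} (hm : k ≤ m) (hn : k ≤ n) (w : List α) :
    Exec (readDims one : Prog α β γ)
      ⟨List.replicate k o ++ z :: (List.replicate m o ++ z :: (List.replicate n o ++ z :: w)),
        [], [], [], 0⟩ (3 * k + 4 * m + 4 * n + 3)
      ⟨w, [], [], [], fun
        | .m => m
        | .n => n
        | .p => m - k
        | .q => n - k
        | _ => 0⟩ := by
  have h1 : ∀ (k : ℕ) (s : Mem α β γ) (w : List α), s.inp = List.replicate k o ++ z :: w →
      Exec (readWhile one (fun _ => Prog.inc .k₁ ;; Prog.inc .k₂)) s (3 * k + 1)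
        { s with
          inp := w
          cnt := update (update s.cnt .k₁ (s.cnt .k₁ + k)) .k₂ (s.cnt .k₂ + k) } := by
    intro k
    induction k with
    | zero =>
      intro s w hs
      refine (readWhile_exit hs hz).weaken ?_ (by omega)
      simp
    | succ k ih =>
      intro s w hs
      refine (readWhile_step (a := o) (by simpa [List.replicate_succ] using hs) ho
        ((inc _ _).seq (inc _ _)) (ih _ w rfl)).weaken ?_ (by omega)
      ext x <;> simp [update_apply]
      grind
  have h2 : ∀ (c i j : Counter), c ≠ i → c ≠ j → i ≠ j →
      ∀ (m : ℕ) (s : Mem α β γ) (w : List α), s.inp = List.replicate m o ++ z :: w →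
      Exec (readWhile one (fun _ => Prog.inc c ;; dec i (Prog.inc j) StackProg.skip)) s (4 * m + 1)
        { s with
          inp := w
          cnt := update (update (update s.cnt c (s.cnt c + m)) j (s.cnt j + (m - s.cnt i)))
            i (s.cnt i - m) } := by
    intro c i j hci hcj hij m
    induction m with
    | zero =>
      intro s w hs
      refine (readWhile_exit hs hz).weaken ?_ (by omega)
      simp
    | succ m ih =>
      intro s w hs
      rcases hi : s.cnt i with _ | y
      · refine (readWhile_step (a := o) (by simpa [List.replicate_succ] using hs) ho
          ((inc _ _).seq (dec_zero ?_ (inc _ _))) (ih _ w rfl)).weaken ?_ (by omega)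
        · simp [hi, hci.symm]
        · ext x <;> simp [update_apply]
          grind
      · refine (readWhile_step (a := o) (by simpa [List.replicate_succ] using hs) ho
          ((inc _ _).seq (dec_succ (j := y) ?_ (skip _))) (ih _ w rfl)).weaken ?_ (by omega)
        · simp [hi, hci.symm]
        · ext x <;> simp [update_apply]
          grind
  refine ((h1 k _ _ rfl).seq ((h2 .m .k₁ .p (by simp) (by simp) (by simp) m _ _ rfl).seq
    (h2 .n .k₂ .q (by simp) (by simp) (by simp) n _ w rfl))).weaken ?_ (by omega)
  ext x <;> try rfl
  cases x <;> simp <;> omega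

end Exec

/-! ### The program that pads a graph -/

namespace Exec

theorem copyOut (s : Mem α β β) :
    Exec (forBuf₁ Prog.writeOut) s (2 * s.buf₁.length + 1)
      { s with buf₁ := [], out := s.buf₁.reverse ++ s.out } := by
  rcases hs : s.buf₁ with _ | ⟨a, l⟩
  · refine (forBuf₁_nil hs).weaken ?_ (by simp)
    ext1 <;> simp [hs]
  · refine (forBuf₁_cons hs (writeOut _ a) (copyOut _)).weaken ?_ (by simp; omega)
    simp
termination_by s.buf₁.length
decreasing_by simp [hs]

end Exec

/-- The word that replaces a symbol of the encoding of a graph when `p` vertices, adjacent to all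
of `V₁`, are added to `V₂`. -/
def padSymbol (p : ℕ) : Option Bool → List (Option Bool)
  | some b => [some b]
  | none => List.replicate p (some true) ++ [none]

/-- The encoding of the padded graph, if `w` is the encoding of the rows of the original one. -/
def padWord (m n p q : ℕ) (w : List (Option Bool)) : List (Option Bool) :=
  List.replicate m (some true) ++ List.replicate q (some true) ++ none ::
    (List.replicate n (some true) ++ List.replicate p (some true) ++ none ::
      (w.flatMap (padSymbol p) ++
        (List.replicate q
          (List.replicate n (some true) ++ List.replicate p (some false) ++ [none])).flatten))

namespace Prog

/-- Write the replacement of a symbol of the rows of the original graph. -/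
def padOldSymbol : Option Bool → Prog (Option Bool) β (Option Bool)
  | some b => write₁ (some b)
  | none => emit .p (some true) ;; write₁ none

/-- Write the transformed rows of the original graph. -/
def padOldRows : Prog (Option Bool) β (Option Bool) := readAll padOldSymbol

/-- Write the rows of the new vertices of `V₁`. -/
def padNewRows : Prog α β (Option Bool) :=
  forCnt .q (emit .n (some true) ;; emit .p (some false) ;; write₁ none)

/-- Transform the encoding of `(G, k)` into that of the padded graph. The output is written to the
first buffer and reversed at the end. -/
def padGraph : Prog (Option Bool) (Option Bool) (Option Bool) :=
  readDims (fun a => a = some true) ;;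
  emit .m (some true) ;; emit .q (some true) ;; write₁ none ;;
  emit .n (some true) ;; emit .p (some true) ;; write₁ none ;;
  padOldRows ;; padNewRows ;; clear .m ;; clear .n ;; clear .p ;; forBuf₁ writeOut

end Prog

namespace Exec

theorem padOldRows (s : Mem (Option Bool) β (Option Bool)) (ht : s.cnt .t = 0) :
    Exec padOldRows s (s.inp.length * (5 * s.cnt .p + 4) + 1)
      { s with
        inp := []
        buf₁ := (s.inp.flatMap (padSymbol (s.cnt .p))).reverse ++ s.buf₁ } := by
  rcases hs : s.inp with _ | ⟨_ | b, l⟩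
  · refine (readWhile_nil hs).weaken ?_ (by simp)
    ext1 <;> simp [hs]
  · refine (readWhile_step hs rfl ((emit (by simp) ?_ _).seq (write₁ _ _))
      (padOldRows _ ?_)).weaken ?_ ?_
    · exact ht
    · exact ht
    · simp [padSymbol]
    · simp only [List.length_cons]
      grind
  · refine (readWhile_step (x := padOldSymbol) hs rfl (write₁ _ _)
      (padOldRows _ ?_)).weaken ?_ ?_
    · exact ht
    · simp [padSymbol]
    · simp only [List.length_cons]
      grind
termination_by s.inp.length
decreasing_by all_goals simp [hs]

theorem padNewRows {s : Mem α β (Option Bool)} (ht : s.cnt .t = 0) {q : ℕ} (hq : s.cnt .q = q) :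
    Exec padNewRows s (q * (5 * s.cnt .n + 5 * s.cnt .p + 6) + 1)
      { s with
        buf₁ := ((List.replicate q (List.replicate (s.cnt .n) (some true) ++
          List.replicate (s.cnt .p) (some false) ++ [none])).flatten).reverse ++ s.buf₁
        cnt := update s.cnt .q 0 } := by
  induction q generalizing s with
  | zero =>
    refine (forCnt_zero hq).weaken ?_ (by omega)
    rw [← hq, update_eq_self]
    simp [hq]
  | succ q ih =>
    refine (forCnt_succ hq ((emit (by simp) ?_ _).seq ((emit (by simp) ?_ _).seq (write₁ _ _)))
      (ih ?_ ?_)).weaken ?_ ?_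
    · simpa using ht
    · simpa using ht
    · simpa using ht
    · simp
    · simp [List.replicate_succ]
    · simp
      grind

theorem padGraph {k m n : ℕ} (hm : k ≤ m) (hn : k ≤ n) (w : List (Option Bool)) :
    Exec padGraph
      ⟨List.replicate k (some true) ++ none :: (List.replicate m (some true) ++ none ::
        (List.replicate n (some true) ++ none :: w)), [], [], [], 0⟩
      (100 * (k + m + n + w.length + 3) ^ 2)
      ⟨[], padWord m n (m - k) (n - k) w, [], [], 0⟩ := by
  refine ((readDims (by simp) (by simp) hm hn w).seq <|
    (emit (by simp) rfl _).seq <| (emit (by simp) rfl _).seq <| (write₁ _ _).seq <|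
    (emit (by simp) rfl _).seq <| (emit (by simp) rfl _).seq <| (write₁ _ _).seq <|
    (padOldRows _ rfl).seq <| (padNewRows rfl rfl).seq <|
    (clear rfl).seq <| (clear rfl).seq <| (clear rfl).seq (copyOut _)).weaken ?_ ?_
  · ext1
    · rfl
    · simp [padWord, add_comm]
    · rfl
    · rfl
    · funext c
      cases c <;> simp
  · simp
    -- The time is bounded by a quadratic polynomial in the sizes, as is seen by bounding each
    -- product by the square of the input length `L`.
    have h0 : (w.map fun a => (padSymbol (m - k) a).length).sum ≤ w.length * (m - k + 1) := by
      rw [← List.length_map (as := w) fun a => (padSymbol (m - k) a).length, ← smul_eq_mul]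
      refine List.sum_le_card_nsmul _ _ fun x hx => ?_
      obtain ⟨_ | b, -, rfl⟩ := List.mem_map.1 hx <;> simp [padSymbol]
    generalize (w.map fun a => (padSymbol (m - k) a).length).sum = x at h0 ⊢
    have hp : m - k ≤ m := by omega
    have hq : n - k ≤ n := by omega
    generalize m - k = p at h0 hp ⊢
    generalize n - k = q at hq ⊢
    generalize w.length = l at h0 ⊢
    obtain ⟨L, hL⟩ : ∃ L, L = k + m + n + l + 3 := ⟨_, rfl⟩
    have h1 : l * p ≤ L * L := Nat.mul_le_mul (by omega) (by omega)
    have h2 : q * n ≤ L * L := Nat.mul_le_mul (by omega) (by omega)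
    have h3 : q * p ≤ L * L := Nat.mul_le_mul (by omega) (by omega)
    have h4 : L * 1 ≤ L * L := Nat.mul_le_mul_left L (by omega)
    rw [← hL]
    linarith

end Exec

/-! ### Perfect matchings of the padded graph -/

/-- The edges of the graph obtained from one with edges `E` by adding `q` vertices to `V₁`, adjacent
to all of the old `V₂`, and `p` vertices to `V₂`, adjacent to all of the old `V₁`. -/
def padEdges {m n : ℕ} (E : Finset (Fin m × Fin n)) (q p : ℕ) :
    Finset (Fin (m + q) × Fin (n + p)) :=
  Finset.univ.filter fun e =>
    Fin.addCases (motive := fun _ => Bool)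
      (fun i => Fin.addCases (motive := fun _ => Bool) (fun j => decide ((i, j) ∈ E))
        (fun _ => true) e.2)
      (fun _ => Fin.addCases (motive := fun _ => Bool) (fun _ => true) (fun _ => false) e.2) e.1

/-- The graph obtained from `G` by adding `n - k` vertices to `V₁`, adjacent to all of the old
`V₂`, and `m - k` vertices to `V₂`, adjacent to all of the old `V₁`. -/
def BipGraph.pad (G : BipGraph) (k : ℕ) : BipGraph where
  m := G.m + (G.n - k)
  n := G.n + (G.m - k)
  E := padEdges G.E (G.n - k) (G.m - k)

/-- The rows of the encoding of a graph. -/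
def BipGraph.encodeRows (G : BipGraph) : List (Option Bool) :=
  (List.ofFn fun i : Fin G.m =>
    (List.ofFn fun j : Fin G.n => some (decide ((i, j) ∈ G.E))) ++ [none]).flatten

theorem BipGraph.encode_eq (G : BipGraph) : G.encode =
    List.replicate G.m (some true) ++ none ::
      (List.replicate G.n (some true) ++ none :: G.encodeRows) := rfl

theorem BipGraph.length_encodeRows (G : BipGraph) : G.encodeRows.length = G.m * (G.n + 1) := by
  simp [encodeRows, List.length_flatten, List.map_ofFn, Function.comp_def]

section

variable {m n : ℕ} (E : Finset (Fin m × Fin n)) {q p : ℕ} (i : Fin m) (j : Fin n) (a : Fin q)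
  (b : Fin p)

theorem castAdd_castAdd_mem_padEdges :
    (Fin.castAdd q i, Fin.castAdd p j) ∈ padEdges E q p ↔ (i, j) ∈ E := by
  simp [padEdges]

theorem castAdd_natAdd_mem_padEdges : (Fin.castAdd q i, Fin.natAdd n b) ∈ padEdges E q p := by
  simp [padEdges]

theorem natAdd_castAdd_mem_padEdges : (Fin.natAdd m a, Fin.castAdd p j) ∈ padEdges E q p := by
  simp [padEdges]

theorem natAdd_natAdd_notMem_padEdges : (Fin.natAdd m a, Fin.natAdd n b) ∉ padEdges E q p := by
  simp [padEdges]

end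

theorem BipGraph.encode_pad (G : BipGraph) (k : ℕ) :
    (G.pad k).encode = padWord G.m G.n (G.m - k) (G.n - k) G.encodeRows := by
  have h1 := castAdd_castAdd_mem_padEdges G.E (q := G.n - k) (p := G.m - k)
  have h2 := castAdd_natAdd_mem_padEdges G.E (q := G.n - k) (p := G.m - k)
  have h3 := natAdd_castAdd_mem_padEdges G.E (q := G.n - k) (p := G.m - k)
  have h4 := natAdd_natAdd_notMem_padEdges G.E (q := G.n - k) (p := G.m - k)
  rw [encode_eq, padWord, ← List.replicate_add, ← List.replicate_add]
  change List.replicate (G.m + (G.n - k)) _ ++ none ::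
    (List.replicate (G.n + (G.m - k)) _ ++ none :: (List.ofFn fun i : Fin (G.m + (G.n - k)) =>
    (List.ofFn fun j : Fin (G.n + (G.m - k)) =>
      some (decide ((i, j) ∈ padEdges G.E (G.n - k) (G.m - k)))) ++ [none]).flatten) = _
  generalize padEdges G.E (G.n - k) (G.m - k) = E at h1 h2 h3 h4
  congr 3
  rw [List.ofFn_add, List.flatten_append]
  simp only [List.ofFn_add]
  refine congrArg (List.cons none) (congrArg₂ List.append ?_ ?_)
  · simp only [encodeRows, List.flatMap_def, List.map_flatten, List.flatten_flatten, List.map_ofFn,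
      Function.comp_def]
    refine congrArg List.flatten (congrArg List.ofFn (funext fun i => ?_))
    have h5 : ∀ l : List Bool, ((l.map some).map (padSymbol (G.m - k))).flatten = l.map some := by
      intro l
      induction l with
      | nil => rfl
      | cons a l ih => simpa [padSymbol] using ih
    have h6 : (List.ofFn fun j => some (decide ((i, j) ∈ G.E))) =
        (List.ofFn fun j => decide ((i, j) ∈ G.E)).map some := by
      rw [List.map_ofFn]; rfl
    rw [List.map_append, List.flatten_append, h6, h5, ← h6]
    change (List.ofFn fun j => some (decide ((Fin.castAdd _ i, Fin.castAdd _ j) ∈ E))) ++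
      (List.ofFn fun j => some (decide ((Fin.castAdd _ i, Fin.natAdd _ j) ∈ E))) ++ _ = _
    simp [h1, h2, padSymbol]
  · rw [← List.ofFn_const]
    refine congrArg List.flatten (congrArg List.ofFn (funext fun a => ?_))
    change (List.ofFn fun j => some (decide ((Fin.natAdd _ a, Fin.castAdd _ j) ∈ E))) ++
      (List.ofFn fun j => some (decide ((Fin.natAdd _ a, Fin.natAdd _ j) ∈ E))) ++ _ = _
    simp [h3, h4]

/-- Perfect matchings are the graphs of the bijections all of whose pairs are edges. -/
theorem card_perfectMatchings {m n : ℕ} (hmn : m = n) (E : Finset (Fin m × Fin n)) :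
    ((E.powersetCard n).filter fun M => BipGraph.IsMatching M).card =
      Fintype.card {σ : Fin m ≃ Fin n // ∀ i, (i, σ i) ∈ E} := by
  rw [← Finset.card_univ]
  symm
  refine Finset.card_bij (fun σ _ => Finset.univ.image fun i => (i, σ.1 i)) ?_ ?_ ?_
  · rintro ⟨σ, hσ⟩ -
    simp only [Finset.mem_filter, Finset.mem_powersetCard]
    refine ⟨⟨?_, ?_⟩, ?_⟩
    · intro e he
      obtain ⟨i, -, rfl⟩ := Finset.mem_image.1 he
      exact hσ i
    · rw [Finset.card_image_of_injective _ fun i i' h => (Prod.ext_iff.1 h).1]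
      simp [hmn]
    · simp only [BipGraph.IsMatching, Finset.mem_image, Finset.mem_univ, true_and]
      rintro _ ⟨i, rfl⟩ _ ⟨i', rfl⟩ h
      have : i ≠ i' := by rintro rfl; exact h rfl
      exact ⟨this, fun h' => this (σ.injective h')⟩
  · rintro ⟨σ, hσ⟩ - ⟨τ, hτ⟩ - h
    ext i : 3
    have h1 : (i, σ i) ∈ Finset.univ.image fun i => (i, τ i) := by
      rw [← show _ = Finset.univ.image fun i => (i, τ i) from h]
      exact Finset.mem_image_of_mem _ (Finset.mem_univ _)
    obtain ⟨i', -, h2⟩ := Finset.mem_image.1 h1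
    obtain ⟨rfl, h3⟩ := Prod.ext_iff.1 h2
    exact congrArg Fin.val h3.symm
  · intro M hM
    simp only [Finset.mem_filter, Finset.mem_powersetCard] at hM
    obtain ⟨⟨hME, hMc⟩, hM⟩ := hM
    have h1 : Set.InjOn Prod.fst (M : Set (Fin m × Fin n)) := fun e he e' he' h => by
      by_contra hne
      exact (hM e he e' he' hne).1 h
    have h2 : M.image Prod.fst = Finset.univ := by
      rw [← Finset.card_eq_iff_eq_univ, Finset.card_image_of_injOn h1]
      simp [hMc, hmn]
    have h3 : ∀ i, ∃ j, (i, j) ∈ M := fun i => by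
      have : i ∈ M.image Prod.fst := h2 ▸ Finset.mem_univ i
      obtain ⟨⟨i', j⟩, h, rfl⟩ := Finset.mem_image.1 this
      exact ⟨j, h⟩
    choose g hg using h3
    have h4 : Function.Injective g := fun i i' h => by
      by_contra hne
      exact (hM _ (hg i) _ (hg i') (fun h' => hne (Prod.ext_iff.1 h').1)).2 h
    have h5 : Function.Bijective g :=
      (Fintype.bijective_iff_injective_and_card g).2 ⟨h4, by simp [hmn]⟩
    refine ⟨⟨Equiv.ofBijective g h5, fun i => hME (hg i)⟩, Finset.mem_univ _, ?_⟩
    refine Finset.eq_of_subset_of_card_le ?_ ?_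
    · intro e he
      obtain ⟨i, -, rfl⟩ := Finset.mem_image.1 he
      exact hg i
    · rw [Finset.card_image_of_injective _ fun i i' h => (Prod.ext_iff.1 h).1]
      simp [hMc, hmn]

section

variable {V₁ V₂ P Q : Type*} [Fintype V₁] [Fintype V₂] [Fintype P] [Fintype Q]
  [DecidableEq V₁] [DecidableEq V₂] [DecidableEq P] [DecidableEq Q]

/-- A matching `M` with `k` edges extends in `#P! * #Q!` ways to a bijection that matches all new
vertices with old ones. -/
theorem card_extensions {k : ℕ} (h₁ : Fintype.card V₁ = k + Fintype.card P)
    (h₂ : Fintype.card V₂ = k + Fintype.card Q) (M : Finset (V₁ × V₂)) (hk : M.card = k)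
    (hM : ∀ e ∈ M, ∀ e' ∈ M, e ≠ e' → e.1 ≠ e'.1 ∧ e.2 ≠ e'.2) :
    Fintype.card {σ : V₁ ⊕ Q ≃ V₂ ⊕ P // (∀ i j, σ (.inl i) = .inl j ↔ (i, j) ∈ M) ∧
      ∀ a b, σ (.inr a) ≠ .inr b} = (Fintype.card Q).factorial * (Fintype.card P).factorial := by
  have m₁ : ∀ {i i' j}, (i, j) ∈ M → (i', j) ∈ M → i = i' := fun {i i' j} h h' => by
    by_contra hne
    exact (hM _ h _ h' fun h => hne (Prod.ext_iff.1 h).1).2 rfl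
  have m₂ : ∀ {i j j'}, (i, j) ∈ M → (i, j') ∈ M → j = j' := fun {i j j'} h h' => by
    by_contra hne
    exact (hM _ h _ h' fun h => hne (Prod.ext_iff.1 h).2).1 rfl
  have c₁ : Fintype.card {i // i ∉ M.image Prod.fst} = Fintype.card P := by
    rw [Fintype.card_subtype_compl, Fintype.card_coe, Finset.card_image_of_injOn, h₁, hk]
    · omega
    · rintro ⟨i, j⟩ h ⟨i', j'⟩ h' (rfl : i = i')
      rw [m₂ h h']
  have c₂ : Fintype.card {j // j ∉ M.image Prod.snd} = Fintype.card Q := by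
    rw [Fintype.card_subtype_compl, Fintype.card_coe, Finset.card_image_of_injOn, h₂, hk]
    · omega
    · rintro ⟨i, j⟩ h ⟨i', j'⟩ h' (rfl : j = j')
      rw [m₁ h h']
  have cc : Fintype.card (V₁ ⊕ Q) = Fintype.card (V₂ ⊕ P) := by
    simp only [Fintype.card_sum]; omega
  rw [← Fintype.card_equiv (Fintype.equivOfCardEq c₂.symm),
    ← c₁, ← Fintype.card_equiv (Fintype.equivOfCardEq c₁), ← Fintype.card_prod]
  symm
  have hex : ∀ i, i ∈ M.image Prod.fst → ∃ j, (i, j) ∈ M := fun i h => by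
    obtain ⟨⟨i', j⟩, h', rfl⟩ := Finset.mem_image.1 h
    exact ⟨j, h'⟩
  choose g hg using hex
  -- The extension given by bijections of `Q` with the vertices of `V₂` that `M` leaves uncovered,
  -- and of those of `V₁` with `P`.
  let F (τ : (Q ≃ {j // j ∉ M.image Prod.snd}) × ({i // i ∉ M.image Prod.fst} ≃ P)) :
      V₁ ⊕ Q → V₂ ⊕ P := Sum.elim
    (fun i => if h : i ∈ M.image Prod.fst then .inl (g i h) else .inr (τ.2 ⟨i, h⟩))
    (fun a => .inl (τ.1 a))
  have F1 : ∀ τ i j, (i, j) ∈ M → F τ (.inl i) = .inl j := fun τ i j h => by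
    have h' : i ∈ M.image Prod.fst := Finset.mem_image_of_mem Prod.fst h
    simp only [F, Sum.elim_inl, h', dite_true, m₂ (hg i h') h]
  have F2 : ∀ τ i, (h : i ∉ M.image Prod.fst) → F τ (.inl i) = .inr (τ.2 ⟨i, h⟩) := fun τ i h => by
    simp only [F, Sum.elim_inl, h, dite_false]
  have F3 : ∀ τ a, F τ (.inr a) = .inl (τ.1 a).1 := fun τ a => rfl
  have F4 : ∀ τ i j, F τ (.inl i) = .inl j ↔ (i, j) ∈ M := fun τ i j => by
    refine ⟨fun h => ?_, F1 τ i j⟩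
    by_cases hi : i ∈ M.image Prod.fst
    · rw [F1 τ i _ (hg i hi)] at h
      rw [← Sum.inl.inj h]
      exact hg i hi
    · rw [F2 τ i hi] at h
      cases h
  have Finj : ∀ τ, Function.Injective (F τ) := by
    rintro τ (i | a) (i' | a') h
    · by_cases hi : i ∈ M.image Prod.fst
      · rw [F1 τ i _ (hg i hi)] at h
        rw [m₁ ((F4 τ i' _).1 h.symm) (hg i hi)]
      · rw [F2 τ i hi] at h
        by_cases hi' : i' ∈ M.image Prod.fst
        · rw [F1 τ i' _ (hg i' hi')] at h
          cases h
        · rw [F2 τ i' hi'] at h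
          exact congrArg Sum.inl (Subtype.ext_iff.1 (τ.2.injective (Sum.inr.inj h)))
    · rw [F3] at h
      exact absurd (Finset.mem_image_of_mem Prod.snd ((F4 τ _ _).1 h)) (τ.1 a').2
    · rw [F3] at h
      exact absurd (Finset.mem_image_of_mem Prod.snd ((F4 τ _ _).1 h.symm)) (τ.1 a).2
    · rw [F3, F3] at h
      rw [τ.1.injective (Subtype.ext (Sum.inl.inj h))]
  have Fbij : ∀ τ, Function.Bijective (F τ) := fun τ =>
    (Fintype.bijective_iff_injective_and_card _).2 ⟨Finj τ, cc⟩
  refine Fintype.card_of_bijective (f := fun τ => ⟨Equiv.ofBijective (F τ) (Fbij τ),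
    F4 τ, fun a b h => by cases h⟩) ⟨?_, ?_⟩
  · rintro τ τ' h
    have h0 : ∀ x, F τ x = F τ' x := fun x => DFunLike.congr_fun (Subtype.ext_iff.1 h) x
    refine Prod.ext (Equiv.ext fun a => ?_) (Equiv.ext fun i => ?_)
    · exact Subtype.ext (Sum.inl.inj (h0 (.inr a)))
    · have := h0 (.inl i)
      rw [F2 _ _ i.2, F2 _ _ i.2] at this
      exact Sum.inr.inj this
  · rintro ⟨σ, hσ, hσ'⟩
    have hq : ∀ a, ∃ j, σ (.inr a) = .inl j := fun a => by
      rcases h : σ (.inr a) with j | b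
      · exact ⟨j, rfl⟩
      · exact absurd h (hσ' a b)
    choose r hr using hq
    have hr' : ∀ a, r a ∉ M.image Prod.snd := fun a h => by
      obtain ⟨⟨i, j⟩, h, h'⟩ := Finset.mem_image.1 h
      have := ((hσ i j).2 h).trans ((congrArg Sum.inl h').trans (hr a).symm)
      cases σ.injective this
    have hp : ∀ i : {i // i ∉ M.image Prod.fst}, ∃ b, σ (.inl i.1) = .inr b := fun i => by
      rcases h : σ (.inl i.1) with j | b
      · exact absurd (Finset.mem_image_of_mem Prod.fst ((hσ _ _).1 h)) i.2
      · exact ⟨b, rfl⟩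
    choose w hw using hp
    have b1 : Function.Bijective fun a => (⟨r a, hr' a⟩ : {j // j ∉ M.image Prod.snd}) := by
      refine (Fintype.bijective_iff_injective_and_card _).2 ⟨fun a a' h => ?_, c₂.symm⟩
      have h1 : r a = r a' := Subtype.ext_iff.1 h
      exact Sum.inr.inj (σ.injective ((hr a).trans ((congrArg Sum.inl h1).trans (hr a').symm)))
    have b2 : Function.Bijective w := by
      refine (Fintype.bijective_iff_injective_and_card _).2 ⟨fun i i' h => ?_, c₁⟩
      exact Subtype.ext (Sum.inl.inj (σ.injective
        ((hw i).trans ((congrArg Sum.inr h).trans (hw i').symm))))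
    refine ⟨(Equiv.ofBijective _ b1, Equiv.ofBijective _ b2), Subtype.ext (Equiv.ext ?_)⟩
    rintro (i | a)
    · by_cases hi : i ∈ M.image Prod.fst
      · exact (F1 _ i _ (hg i hi)).trans ((hσ _ _).2 (hg i hi)).symm
      · exact (F2 _ i hi).trans (hw ⟨i, hi⟩).symm
    · exact (hr a).symm

/-- Each `k`-matching extends in equally many ways to a bijection that consists of edges between old
vertices and of pairs of an old and a new vertex. -/
theorem card_padded_equiv {k : ℕ} (h₁ : Fintype.card V₁ = k + Fintype.card P)
    (h₂ : Fintype.card V₂ = k + Fintype.card Q) (E : Finset (V₁ × V₂)) :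
    Nat.card {σ : V₁ ⊕ Q ≃ V₂ ⊕ P // (∀ i j, σ (.inl i) = .inl j → (i, j) ∈ E) ∧
      ∀ a b, σ (.inr a) ≠ .inr b} =
    ((E.powersetCard k).filter fun M =>
      ∀ e ∈ M, ∀ e' ∈ M, e ≠ e' → e.1 ≠ e'.1 ∧ e.2 ≠ e'.2).card *
      ((Fintype.card Q).factorial * (Fintype.card P).factorial) := by
  classical
  rw [Nat.card_eq_fintype_card]
  let R (σ : V₁ ⊕ Q ≃ V₂ ⊕ P) : Finset (V₁ × V₂) :=
    Finset.univ.filter fun e => σ (.inl e.1) = .inl e.2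
  have hR : ∀ σ i j, (i, j) ∈ R σ ↔ σ (.inl i) = .inl j := fun σ i j => by simp [R]
  rw [Fintype.card_subtype, Finset.card_eq_sum_card_fiberwise (f := R)
    (t := (E.powersetCard k).filter fun M =>
      ∀ e ∈ M, ∀ e' ∈ M, e ≠ e' → e.1 ≠ e'.1 ∧ e.2 ≠ e'.2)]
  · rw [Finset.sum_const_nat fun M hM => ?_]
    simp only [Finset.mem_filter, Finset.mem_powersetCard] at hM
    rw [← card_extensions h₁ h₂ M hM.1.2 hM.2, Fintype.card_subtype, Finset.filter_filter]
    congr 1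
    ext σ
    simp only [Finset.mem_filter, Finset.mem_univ, true_and]
    constructor
    · rintro ⟨⟨h, h'⟩, rfl⟩
      exact ⟨fun i j => (hR σ i j).symm, h'⟩
    · rintro ⟨h, h'⟩
      refine ⟨⟨fun i j hij => hM.1.1 ((h i j).1 hij), h'⟩, ?_⟩
      ext ⟨i, j⟩
      rw [hR, h]
  · intro σ hσ
    simp only [Finset.coe_filter, Finset.mem_univ, true_and, Set.mem_ofPred_eq] at hσ
    obtain ⟨h, h'⟩ := hσ
    simp only [Finset.coe_filter, Finset.mem_powersetCard, Set.mem_ofPred_eq]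
    have m₁ : ∀ {i i' j}, (i, j) ∈ R σ → (i', j) ∈ R σ → i = i' := fun {i i' j} he he' =>
      Sum.inl.inj (σ.injective (((hR _ _ _).1 he).trans ((hR _ _ _).1 he').symm))
    have m₂ : ∀ {i j j'}, (i, j) ∈ R σ → (i, j') ∈ R σ → j = j' := fun {i j j'} he he' =>
      Sum.inl.inj (((hR _ _ _).1 he).symm.trans ((hR _ _ _).1 he'))
    refine ⟨⟨fun ⟨i, j⟩ he => h i j ((hR _ _ _).1 he), ?_⟩, ?_⟩
    · -- The new vertices of `V₁` are matched with `#Q` old vertices of `V₂`, the other old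
      -- vertices of `V₂` are covered by `R σ`.
      have c1 : ((R σ).image Prod.snd).card = (R σ).card := by
        refine Finset.card_image_of_injOn ?_
        rintro ⟨i, j⟩ he ⟨i', j'⟩ he' (rfl : j = j')
        rw [m₁ he he']
      have c2 : (R σ).image Prod.snd = Finset.univ.filter fun j => (σ.symm (.inl j)).isLeft := by
        ext j
        simp only [Finset.mem_image, Prod.exists, exists_eq_right, hR, Finset.mem_filter,
          Finset.mem_univ, true_and, Sum.isLeft_iff, Equiv.symm_apply_eq]
        exact exists_congr fun i => eq_comm
      have c3 : (Finset.univ.filter fun j => ¬ (σ.symm (.inl j)).isLeft = true).card =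
          Fintype.card Q := by
        have hq : ∀ a, ∃ j, σ (.inr a) = .inl j := fun a => by
          rcases h0 : σ (.inr a) with j | b
          · exact ⟨j, rfl⟩
          · exact absurd h0 (h' a b)
        choose r hr using hq
        rw [← Finset.card_univ]
        symm
        refine Finset.card_bij (fun a _ => r a) ?_ ?_ ?_
        · intro a _
          simp [← hr a]
        · intro a _ a' _ haa
          exact Sum.inr.inj (σ.injective ((hr a).trans ((congrArg Sum.inl haa).trans (hr a').symm)))
        · intro j hj
          simp only [Finset.mem_filter, Finset.mem_univ, true_and, Bool.not_eq_true,
            Sum.isLeft_eq_false, Sum.isRight_iff] at hj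
          obtain ⟨a, ha⟩ := hj
          refine ⟨a, Finset.mem_univ _, ?_⟩
          rw [Equiv.symm_apply_eq, hr] at ha
          exact (Sum.inl.inj ha).symm
      have c4 := Finset.card_filter_add_card_filter_not (s := (Finset.univ : Finset V₂))
        (fun j => (σ.symm (.inl j)).isLeft = true)
      rw [c3, ← c2, c1, Finset.card_univ, h₂] at c4
      omega
    · rintro ⟨i, j⟩ he ⟨i', j'⟩ he' hne
      exact ⟨fun (h0 : i = i') => hne (by subst h0; rw [m₂ he he']),
        fun (h0 : j = j') => hne (by subst h0; rw [m₁ he he'])⟩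

end

/-- The perfect matchings of the padded graph are the extensions of the `k`-matchings. -/
theorem BipGraph.numMatchings_pad (G : BipGraph) {k : ℕ} (hm : k ≤ G.m) (hn : k ≤ G.n) :
    (G.pad k).numMatchings (G.pad k).n =
      G.numMatchings k * ((G.n - k).factorial * (G.m - k).factorial) := by
  have h1 := card_padded_equiv (V₁ := Fin G.m) (V₂ := Fin G.n) (P := Fin (G.m - k))
    (Q := Fin (G.n - k)) (k := k) (by simp; omega) (by simp; omega) G.E
  simp only [Fintype.card_fin] at h1
  refine (card_perfectMatchings (m := G.m + (G.n - k)) (n := G.n + (G.m - k)) (by omega)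
    (padEdges G.E (G.n - k) (G.m - k))).trans (Eq.trans ?_ h1)
  rw [← Nat.card_eq_fintype_card]
  symm
  refine Nat.card_congr
    ((Equiv.equivCongr finSumFinEquiv finSumFinEquiv).subtypeEquiv fun σ => ?_)
  have h2 : (∀ i, (i, Equiv.equivCongr finSumFinEquiv finSumFinEquiv σ i) ∈
      padEdges G.E (G.n - k) (G.m - k)) ↔ ∀ x, (finSumFinEquiv x, finSumFinEquiv (σ x)) ∈
      padEdges G.E (G.n - k) (G.m - k) := by
    rw [← finSumFinEquiv.forall_congr_right]
    simp
  rw [h2]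
  constructor
  · rintro ⟨h, h'⟩ (i | a)
    · rcases hx : σ (.inl i) with j | b
      · simpa [castAdd_castAdd_mem_padEdges] using h i j hx
      · simpa using castAdd_natAdd_mem_padEdges G.E i b
    · rcases hx : σ (.inr a) with j | b
      · simpa using natAdd_castAdd_mem_padEdges G.E j a
      · exact absurd hx (h' a b)
  · intro h
    refine ⟨fun i j hx => ?_, fun a b hx => ?_⟩
    · have := h (.inl i)
      rw [hx] at this
      simpa [castAdd_castAdd_mem_padEdges] using this
    · have := h (.inr a)
      rw [hx] at this
      exact natAdd_natAdd_notMem_padEdges G.E a b (by simpa using this)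

/-! ### Dividing out factorials -/

/-- The number with the given binary digits, most significant first, preceded by those of `v`. -/
def msbVal (v : ℕ) (l : List Bool) : ℕ := l.foldl (fun v b => 2 * v + b.toNat) v

theorem msbVal_reverse_bits (v : ℕ) : msbVal 0 (Nat.bits v).reverse = v := by
  induction v using Nat.binaryRec' with
  | zero => simp [msbVal]
  | bit b n hn ih =>
    rw [Nat.bits_append_bit n b hn, List.reverse_cons, msbVal, List.foldl_append]
    rw [msbVal] at ih
    rw [ih]
    cases b <;> simp [Nat.bit]

namespace Prog

/-- One step of long division by the counter `c`: bring down the digit `b` to the remainder `e`, and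
write a digit of the quotient to the second buffer. The number `2 * e + b` is formed in `t`. If it
is less than `c`, then `f` becomes positive and `v` equal to it, so that `v` is the new remainder;
otherwise `t` is decreased by `c` and is the new remainder. -/
def divDigit (c : Counter) (b : Bool) : Prog α β Bool :=
  ((forCnt .e (inc .t ;; inc .t) ;; (if b then inc .t else skip)) ;;
    forCnt c (inc .u ;; dec .t (inc .f) (inc .v))) ;;
  dec .f (write₂ true ;; clear .v ;; move .t .e) (write₂ false ;; clear .f ;; move .v .e) ;;
  move .u c

/-- Divide the binary number in the first buffer, whose most significant digit is on top, by the
counter `c`. -/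
def divide (c : Counter) : Prog α β Bool :=
  forBuf₁ (divDigit c) ;; clear .e ;; forBuf₂ write₁

/-- Divide the number in the first buffer by the factorial of the counter `c`, by dividing it by the
counter while this is decreased to zero. As the loop decreases the counter before its body is run,
the body starts by increasing it again. -/
def divideFactorial (c : Counter) : Prog α β Bool :=
  forCnt c (inc c ;; divide c ;; dec c skip skip)

/-- Restore the top of the output that has been removed, and write `false` unless there is none. -/
def writeZero : Option Bool → Prog α Bool γ
  | none => skip
  | some a => writeOut a ;; writeOut false

/-- Replace the binary digits of `v` on the output by those of `2 * v + b`. As `Nat.bits` has no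
leading zeros, `false` is not written on the empty word. -/
def writeBit : Bool → Prog α Bool Bool
  | true => writeOut true
  | false => pop .out writeZero

/-- Put a symbol on the first buffer if it is a binary digit, and ignore it otherwise. -/
def readBit {δ : Type} : δ ⊕ Bool → Prog (δ ⊕ Bool) β Bool
  | .inl _ => skip
  | .inr b => write₁ b

/-- Read the rest of an input word, putting the binary digits of its second part on the first
buffer. -/
def readBits {δ : Type} : Prog (δ ⊕ Bool) β Bool := readAll readBit

/-- Divide a number by `(m - k)!` and `(n - k)!`. -/
def unpad : Prog (Option Bool ⊕ Bool) Bool Bool :=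
  (readDims (fun a => a = .inl (some true)) ;; clear .m ;; clear .n ;; readBits) ;;
  divideFactorial .p ;; divideFactorial .q ;; forBuf₁ writeBit

end Prog

namespace Exec

theorem doubleRemainder {n : ℕ} {s : Mem α β γ} (he : s.cnt .e = n) :
    Exec (forCnt .e (Prog.inc .t ;; Prog.inc .t)) s (3 * n + 1)
      { s with cnt := update (update s.cnt .e 0) .t (s.cnt .t + 2 * n) } := by
  induction n generalizing s with
  | zero =>
    refine (forCnt_zero he).weaken ?_ (by omega)
    rw [← he, update_eq_self, he, mul_zero, add_zero, update_eq_self]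
  | succ n ih =>
    refine (forCnt_succ he ((inc _ _).seq (inc _ _)) (ih ?_)).weaken ?_ (by omega)
    · simp
    · ext x <;> simp [update_apply]
      grind

/-- The comparison of `t` with `c`: if `u`, `f`, `v` are zero at first, then `u` keeps a copy of
`c`, `f` and the new value of `t` are the truncated differences of the two, and `v` is the minimum. -/
theorem compare {c : Counter} (hu : c ≠ .u) (ht : c ≠ .t) (hf : c ≠ .f) (hv : c ≠ .v) {n : ℕ}
    {s : Mem α β γ} (hc : s.cnt c = n) :
    Exec (forCnt c (Prog.inc .u ;; dec .t (Prog.inc .f) (Prog.inc .v))) s (4 * n + 1)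
      { s with
        cnt := update (update (update (update (update s.cnt c 0) .u (s.cnt .u + n))
            .t (s.cnt .t - n)) .f (s.cnt .f + (n - s.cnt .t)))
            .v (s.cnt .v + min n (s.cnt .t)) } := by
  induction n generalizing s with
  | zero =>
    refine (forCnt_zero hc).weaken ?_ (by omega)
    ext x <;> simp [update_apply]
    grind
  | succ n ih =>
    rcases hx : s.cnt .t with _ | y
    · refine (forCnt_succ hc ((inc _ _).seq (dec_zero ?_ (inc _ _))) (ih ?_)).weaken ?_ (by omega)
      · simp [hx, ht.symm]
      · simp [hu, hf]
      · ext x <;> simp [update_apply]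
        grind
    · refine (forCnt_succ hc ((inc _ _).seq (dec_succ (j := y) ?_ (inc _ _))) (ih ?_)).weaken ?_
        (by omega)
      · simp [hx, ht.symm]
      · simp [hu, hv, ht]
      · ext x <;> simp [update_apply]
        grind

/-- A counter by which numbers are divided; it is not part of the working memory of the division. -/
def Free (c : Counter) : Prop := c = .p ∨ c = .q

theorem divDigit {c : Counter} (hc : Free c) {s : Mem α β Bool} {d r : ℕ} (hd : s.cnt c = d)
    (hr : s.cnt .e = r) (hrd : r < d) (ht : s.cnt .t = 0) (hu : s.cnt .u = 0)
    (hv : s.cnt .v = 0) (hf : s.cnt .f = 0) (b : Bool) :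
    Exec (divDigit c b) s (20 * d + 20)
      { s with
        buf₂ := decide (d ≤ 2 * r + b.toNat) :: s.buf₂
        cnt := update s.cnt .e (if d ≤ 2 * r + b.toNat then 2 * r + b.toNat - d
          else 2 * r + b.toNat) } := by
  have c1 : c ≠ .e := by rcases hc with rfl | rfl <;> simp
  have c2 : c ≠ .t := by rcases hc with rfl | rfl <;> simp
  have c3 : c ≠ .u := by rcases hc with rfl | rfl <;> simp
  have c4 : c ≠ .v := by rcases hc with rfl | rfl <;> simp
  have c5 : c ≠ .f := by rcases hc with rfl | rfl <;> simp
  obtain ⟨T, hT⟩ : ∃ T, T = 2 * r + b.toNat := ⟨_, rfl⟩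
  rw [← hT]
  have e1 : Exec (forCnt .e (Prog.inc .t ;; Prog.inc .t) ;;
      (if b then Prog.inc .t else StackProg.skip)) s (3 * r + 2)
      { s with cnt := update (update s.cnt .e 0) .t T } := by
    refine ((doubleRemainder hr).seq (n' := 1) (s'' := { s with
      cnt := update (update s.cnt .e 0) .t T }) ?_).weaken rfl (by omega)
    cases b with
    | false =>
      refine (skip _).weaken ?_ le_rfl
      simp [ht, hT]
    | true =>
      refine (inc _ _).weaken ?_ le_rfl
      simp [ht, hT]
  have e2 := e1.seq (compare (c := c) c3 c2 c5 c4 (n := d) (by simp [c1, c2, hd]))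
  simp only [ne_eq, reduceCtorEq, not_false_eq_true, update_of_ne, update_self, hu, hf, hv,
    zero_add] at e2
  rcases le_or_gt d T with h | h
  · refine (e2.seq ((dec_zero (by simp; omega)
      ((write₂ _ _).seq ((clear (n := d) (by simp; omega)).seq
        (move (by simp) (n := T - d) (by simp))))).seq
      (move c3.symm (n := d) (by simp)))).weaken ?_ ?_
    · rw [if_pos h, decide_eq_true h]
      ext x <;> simp [update_apply]
      grind
    · cases b <;> grind
  · refine (e2.seq ((dec_succ (j := d - T - 1) (by simp; omega)
      ((write₂ _ _).seq ((clear (n := d - T - 1) (by simp)).seq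
        (move (by simp) (n := T) (by simp; omega))))).seq
      (move c3.symm (n := d) (by simp)))).weaken ?_ ?_
    · rw [if_neg h.not_ge, decide_eq_false h.not_ge]
      ext x <;> simp [update_apply]
      grind
    · grind

/-- Long division of the digits `l`, preceded by a remainder `r`: if the part of the quotient found
so far is `v`, the number to be divided is `msbVal (d * v + r) l`, and `l'` are the further digits
of the quotient. -/
theorem divDigits {c : Counter} (hc : Free c) {d : ℕ} (l : List Bool) {s : Mem α β Bool} {r : ℕ}
    (hl : s.buf₁ = l) (hd : s.cnt c = d) (hr : s.cnt .e = r) (hrd : r < d) (ht : s.cnt .t = 0)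
    (hu : s.cnt .u = 0) (hv : s.cnt .v = 0) (hf : s.cnt .f = 0) :
    ∃ (l' : List Bool) (r' : ℕ), l'.length = l.length ∧ r' < d ∧
      (∀ v, msbVal (d * v + r) l = d * msbVal v l' + r') ∧
      Exec (forBuf₁ (Prog.divDigit c)) s (l.length * (20 * d + 21) + 1)
        { s with buf₁ := [], buf₂ := l'.reverse ++ s.buf₂, cnt := update s.cnt .e r' } := by
  have c1 : c ≠ .e := by rcases hc with rfl | rfl <;> simp
  induction l generalizing s r with
  | nil =>
    refine ⟨[], r, rfl, hrd, fun v => rfl, (forBuf₁_nil hl).weaken ?_ (by simp)⟩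
    rw [← hr, update_eq_self]
    ext1 <;> simp [hl]
  | cons b l ih =>
    obtain ⟨r₁, hr₁⟩ : ∃ r₁, r₁ = if d ≤ 2 * r + b.toNat then 2 * r + b.toNat - d
      else 2 * r + b.toNat := ⟨_, rfl⟩
    have hb : b.toNat ≤ 1 := Bool.toNat_le b
    have e1 := divDigit hc (s := { s with buf₁ := l }) hd hr hrd ht hu hv hf b
    rw [← hr₁] at e1
    obtain ⟨l', r', h1, h2, h3, h4⟩ := ih (s := { s with
      buf₁ := l, buf₂ := decide (d ≤ 2 * r + b.toNat) :: s.buf₂, cnt := update s.cnt .e r₁ })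
      (r := r₁) rfl (by simpa [c1] using hd) (by simp) (by rw [hr₁]; split_ifs <;> omega)
      (by simpa using ht) (by simpa using hu) (by simpa using hv) (by simpa using hf)
    refine ⟨decide (d ≤ 2 * r + b.toNat) :: l', r', by simp [h1], h2, fun v => ?_,
      (forBuf₁_cons hl e1 h4).weaken ?_ ?_⟩
    · refine Eq.trans ?_ (h3 (2 * v + (decide (d ≤ 2 * r + b.toNat)).toNat))
      simp only [msbVal, List.foldl_cons]
      congr 1
      rw [hr₁]
      split_ifs with h
      · simp only [h, decide_true, Bool.toNat_true, mul_add, mul_one]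
        rw [mul_left_comm]
        omega
      · simp only [h, decide_false, Bool.toNat_false, mul_add, add_zero]
        rw [mul_left_comm]
        omega
    · simp
    · simp only [List.length_cons]
      grind

theorem moveBuf (s : Mem α β γ) :
    Exec (forBuf₂ Prog.write₁) s (2 * s.buf₂.length + 1)
      { s with buf₁ := s.buf₂.reverse ++ s.buf₁, buf₂ := [] } := by
  rcases hs : s.buf₂ with _ | ⟨a, l⟩
  · refine (forBuf₂_nil hs).weaken ?_ (by simp)
    ext1 <;> simp [hs]
  · refine (forBuf₂_cons hs (write₁ _ a) (moveBuf _)).weaken ?_ (by simp; omega)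
    simp
termination_by s.buf₂.length
decreasing_by simp [hs]

theorem divide {c : Counter} (hc : Free c) {d : ℕ} (h0 : 0 < d) {s : Mem α β Bool}
    (hd : s.cnt c = d) (hs : s.buf₂ = []) (he : s.cnt .e = 0) (ht : s.cnt .t = 0)
    (hu : s.cnt .u = 0) (hv : s.cnt .v = 0) (hf : s.cnt .f = 0) :
    ∃ l' : List Bool, l'.length = s.buf₁.length ∧ msbVal 0 l' = msbVal 0 s.buf₁ / d ∧
      Exec (divide c) s (s.buf₁.length * (20 * d + 23) + 2 * d + 3) { s with buf₁ := l' } := by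
  obtain ⟨l', r', h1, h2, h3, h4⟩ := divDigits hc _ rfl hd he h0 ht hu hv hf
  refine ⟨l', h1, ?_, (h4.seq ((clear rfl).seq (moveBuf _))).weaken ?_ ?_⟩
  · have := h3 0
    simp only [mul_zero, add_zero] at this
    rw [this, Nat.mul_add_div h0, Nat.div_eq_of_lt h2, add_zero]
  · ext x <;> simp [hs]
    grind [update_apply]
  · simp [hs, h1]
    grind

theorem divideFactorial {c : Counter} (hc : Free c) {n N : ℕ} (hN : n ≤ N) {s : Mem α β Bool}
    (hn : s.cnt c = n) (hs : s.buf₂ = []) (he : s.cnt .e = 0) (ht : s.cnt .t = 0)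
    (hu : s.cnt .u = 0) (hv : s.cnt .v = 0) (hf : s.cnt .f = 0) :
    ∃ l' : List Bool, l'.length = s.buf₁.length ∧ msbVal 0 l' = msbVal 0 s.buf₁ / n.factorial ∧
      Exec (divideFactorial c) s (n * (s.buf₁.length * (20 * N + 23) + 2 * N + 8) + 1)
        { s with buf₁ := l', cnt := update s.cnt c 0 } := by
  have c1 : .e ≠ c := by rcases hc with rfl | rfl <;> simp
  have c2 : .t ≠ c := by rcases hc with rfl | rfl <;> simp
  have c3 : .u ≠ c := by rcases hc with rfl | rfl <;> simp
  have c4 : .v ≠ c := by rcases hc with rfl | rfl <;> simp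
  have c5 : .f ≠ c := by rcases hc with rfl | rfl <;> simp
  induction n generalizing s with
  | zero =>
    refine ⟨s.buf₁, rfl, by simp, (forCnt_zero hn).weaken ?_ (by simp)⟩
    rw [← hn, update_eq_self]
  | succ n ih =>
    obtain ⟨l', h1, h2, h3⟩ := divide (s := { s with cnt := update s.cnt c (n + 1) }) hc
      (Nat.succ_pos n) (by simp) hs (by simpa [c1] using he) (by simpa [c2] using ht)
      (by simpa [c3] using hu) (by simpa [c4] using hv) (by simpa [c5] using hf)
    obtain ⟨l'', h1', h2', h3'⟩ := ih (s := { s with buf₁ := l', cnt := update s.cnt c n })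
      (by omega) (by simp) hs (by simpa [c1] using he) (by simpa [c2] using ht)
      (by simpa [c3] using hu) (by simpa [c4] using hv) (by simpa [c5] using hf)
    have e : Exec (Prog.inc c ;; Prog.divide c ;; dec c StackProg.skip StackProg.skip)
        { s with cnt := update s.cnt c n } (s.buf₁.length * (20 * N + 23) + 2 * N + 6)
        { s with buf₁ := l', cnt := update s.cnt c n } := by
      refine (((inc _ c).weaken (s'' := { s with cnt := update s.cnt c (n + 1) }) (by simp)
        le_rfl).seq (h3.seq (dec_succ (i := c) (j := n) (by simp) (skip _)))).weaken (by simp) ?_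
      have : s.buf₁.length * (20 * (n + 1) + 23) ≤ s.buf₁.length * (20 * N + 23) := by gcongr
      simp only [Nat.succ_eq_add_one]
      omega
    refine ⟨l'', h1'.trans h1, ?_, (forCnt_succ hn e h3').weaken ?_ ?_⟩
    · rw [h2', h2, Nat.div_div_eq_div_mul, Nat.factorial_succ]
    · simp
    · simp only [h1]
      grind

theorem writeBits (l : List Bool) {v : ℕ} {s : Mem α Bool Bool} (hl : s.buf₁ = l)
    (hv : s.out = Nat.bits v) :
    Exec (forBuf₁ writeBit) s (4 * l.length + 1)
      { s with buf₁ := [], out := Nat.bits (msbVal v l) } := by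
  induction l generalizing s v with
  | nil =>
    refine (forBuf₁_nil hl).weaken ?_ (by simp)
    ext1 <;> simp [hl, hv, msbVal]
  | cons b l ih =>
    have e : Exec (writeBit b) { s with buf₁ := l } 3
        { s with buf₁ := l, out := Nat.bits (2 * v + b.toNat) } := by
      cases b with
      | true =>
        refine (writeOut _ _).weaken ?_ (by omega)
        simp [hv, Nat.bit1_bits]
      | false =>
        rcases Nat.eq_zero_or_pos v with rfl | h0
        · refine (popOut_nil (x := writeZero) (by simpa using hv) (skip _)).weaken ?_ ?_
          · simpa using hv
          · omega
        · have h1 : Nat.bits (2 * v) = false :: Nat.bits v := Nat.bit0_bits v h0.ne'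
          rcases ho : s.out with _ | ⟨a, o⟩
          · rw [ho] at hv
            have := msbVal_reverse_bits v
            rw [← hv] at this
            exact absurd this.symm h0.ne'
          · refine (popOut_cons (s := { s with out := a :: o, buf₁ := l }) (x := writeZero) rfl
              ((writeOut _ _).seq (writeOut _ _))).weaken ?_ ?_
            · simp [h1, ← hv, ho]
            · omega
    refine (forBuf₁_cons hl e (ih rfl rfl)).weaken ?_ ?_
    · simp [msbVal]
    · simp only [List.length_cons]
      omega

theorem readBits {δ : Type} (w : List δ) (l : List Bool) {s : Mem (δ ⊕ Bool) β Bool}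
    (hs : s.inp = w.map .inl ++ l.map .inr) :
    Exec readBits s (2 * (w.length + l.length) + 1)
      { s with inp := [], buf₁ := l.reverse ++ s.buf₁ } := by
  induction w generalizing s with
  | nil =>
    induction l generalizing s with
    | nil =>
      refine (readWhile_nil (by simpa using hs)).weaken ?_ (by simp)
      ext1 <;> simp [hs]
    | cons b l ih =>
      refine (readWhile_step (x := readBit) (a := .inr b) (by simpa using hs) rfl (write₁ _ b)
        (ih ?_)).weaken ?_ ?_
      · simp
      · simp
      · simp; omega
  | cons a w ih =>
    refine (readWhile_step (x := readBit) (a := .inl a) (by simpa using hs) rfl (skip _)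
      (ih ?_)).weaken ?_ ?_
    · simp
    · simp
    · simp; omega

theorem unpad {k m n : ℕ} (hm : k ≤ m) (hn : k ≤ n) (w : List (Option Bool)) (N : ℕ) :
    Exec unpad
      ⟨(List.replicate k (some true) ++ none :: (List.replicate m (some true) ++ none ::
        (List.replicate n (some true) ++ none :: w))).map .inl ++ (Nat.bits N).map .inr,
        [], [], [], 0⟩
      (100 * (k + m + n + w.length + (Nat.bits N).length + 3) ^ 3)
      ⟨[], Nat.bits (N / ((n - k).factorial * (m - k).factorial)), [], [], 0⟩ := by
  have e1 : Exec (Prog.readDims (fun a => a = .inl (some true)) ;; Prog.clear .m ;; Prog.clear .n ;;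
      Prog.readBits)
      ⟨(List.replicate k (some true) ++ none :: (List.replicate m (some true) ++ none ::
        (List.replicate n (some true) ++ none :: w))).map .inl ++ (Nat.bits N).map .inr,
        [], [], [], 0⟩ (3 * k + 6 * m + 6 * n + 2 * w.length + 2 * (Nat.bits N).length + 10)
      (⟨[], [], (Nat.bits N).reverse, [], fun
        | .p => m - k
        | .q => n - k
        | _ => 0⟩ : Mem _ Bool _) := by
    simp only [List.map_append, List.map_cons, List.map_replicate, List.append_assoc,
      List.cons_append]
    refine ((readDims (by simp) (by simp) hm hn _).seq <| (clear rfl).seq <|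
      (clear rfl).seq (readBits w _ rfl)).weaken ?_ ?_
    · ext1
      · rfl
      · rfl
      · simp
      · rfl
      · funext c
        cases c <;> simp
    · simp
      omega
  obtain ⟨l₁, h1, h2, h3⟩ := divideFactorial (c := .p) (n := m - k) (N := m) (Or.inl rfl)
    (Nat.sub_le _ _) (s := (⟨[], [], (Nat.bits N).reverse, [], fun
        | .p => m - k
        | .q => n - k
        | _ => 0⟩ : Mem (Option Bool ⊕ Bool) Bool _)) rfl rfl rfl rfl rfl rfl rfl
  obtain ⟨l₂, h1', h2', h3'⟩ := divideFactorial (c := .q) (n := n - k) (N := n) (Or.inr rfl)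
    (Nat.sub_le _ _) (s := (⟨[], [], l₁, [], fun
        | .q => n - k
        | _ => 0⟩ : Mem (Option Bool ⊕ Bool) Bool _)) rfl rfl rfl rfl rfl rfl rfl
  refine (e1.seq ((h3.weaken ?_ le_rfl).seq ((h3'.weaken ?_ le_rfl).seq
    (writeBits l₂ (v := 0) (s := ⟨[], [], l₂, [], 0⟩) rfl (by simp))))).weaken ?_ ?_
  · ext1 <;> try rfl
    funext c
    cases c <;> simp
  · ext1 <;> try rfl
    funext c
    cases c <;> simp
  · simp only [h2', h2, msbVal_reverse_bits, Nat.div_div_eq_div_mul]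
    rw [mul_comm]
  · simp only [h1', h1, List.length_reverse]
    generalize (Nat.bits N).length = l
    generalize w.length = x
    have hp : m - k ≤ m := Nat.sub_le _ _
    have hq : n - k ≤ n := Nat.sub_le _ _
    generalize m - k = p at hp ⊢
    generalize n - k = q at hq ⊢
    obtain ⟨L, hL⟩ : ∃ L, L = k + m + n + x + l + 3 := ⟨_, rfl⟩
    rw [← hL]
    have h1 : p * (l * (20 * m + 23) + 2 * m + 8) ≤ L * (L * (20 * L + 23) + 2 * L + 8) := by
      gcongr <;> omega
    have h2 : q * (l * (20 * n + 23) + 2 * n + 8) ≤ L * (L * (20 * L + 23) + 2 * L + 8) := by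
      gcongr <;> omega
    have h3 : 3 * L ≤ L * L := Nat.mul_le_mul_right L (by omega)
    have h4 : 3 * (L * L) ≤ L * (L * L) := Nat.mul_le_mul_right (L * L) (by omega)
    rw [show L ^ 3 = L * (L * L) by ring]
    linarith

end Exec

/-! ### The reductions and the input length -/

namespace Prog

/-- Duplicate the first block of a word. -/
def dupBlock : Prog (Option Bool) (Option Bool) (Option Bool) :=
  readWhile (fun a => a = some true) (fun _ => inc .m) ;;
  emit .m (some true) ;; write₁ none ;; emit .m (some true) ;; write₁ none ;;
  readAll write₁ ;; clear .m ;; forBuf₁ writeOut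

/-- Return the binary digits in the second part of a word. -/
def projNat {δ : Type} : Prog (δ ⊕ Bool) Bool Bool := readBits ;; forBuf₁ writeOut

end Prog

namespace Exec

theorem readBlock {s : Mem (Option Bool) β γ} {n : ℕ} {w : List (Option Bool)}
    (hs : s.inp = List.replicate n (some true) ++ none :: w) :
    Exec (readWhile (fun a => a = some true) (fun _ => Prog.inc .m)) s (2 * n + 1)
      { s with inp := w, cnt := update s.cnt .m (s.cnt .m + n) } := by
  induction n generalizing s with
  | zero =>
    refine (readWhile_exit hs (by simp)).weaken ?_ (by omega)
    simp
  | succ n ih =>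
    refine (readWhile_step (a := some true) (by simpa [List.replicate_succ] using hs) (by simp)
      (inc _ _) (ih rfl)).weaken ?_ (by omega)
    simp [add_assoc, add_comm 1]

theorem copyInp (s : Mem α β α) :
    Exec (readAll Prog.write₁) s (2 * s.inp.length + 1)
      { s with inp := [], buf₁ := s.inp.reverse ++ s.buf₁ } := by
  rcases hs : s.inp with _ | ⟨a, l⟩
  · refine (readWhile_nil hs).weaken ?_ (by simp)
    ext1 <;> simp [hs]
  · refine (readWhile_step hs rfl (write₁ _ a) (copyInp _)).weaken ?_ (by simp; omega)
    simp
termination_by s.inp.length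
decreasing_by simp [hs]

theorem dupBlock (n : ℕ) (w : List (Option Bool)) :
    Exec dupBlock ⟨List.replicate n (some true) ++ none :: w, [], [], [], 0⟩
      (20 * (n + w.length + 1))
      ⟨[], List.replicate n (some true) ++ none :: (List.replicate n (some true) ++ none :: w),
        [], [], 0⟩ := by
  refine ((readBlock rfl).seq <| (emit (by simp) rfl _).seq <| (write₁ _ _).seq <|
    (emit (by simp) rfl _).seq <| (write₁ _ _).seq <| (copyInp _).seq <|
    (clear rfl).seq <| copyOut _).weaken ?_ ?_
  · ext1
    · rfl
    · simp
    · rfl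
    · rfl
    · simp
  · simp
    omega

theorem projNat {δ : Type} (w : List δ) (l : List Bool) :
    Exec projNat ⟨w.map .inl ++ l.map .inr, [], [], [], 0⟩ (4 * (w.length + l.length) + 2)
      ⟨[], l, [], [], 0⟩ := by
  refine ((readBits w l rfl).seq (copyOut _)).weaken ?_ ?_
  · simp
  · simp
    omega

end Exec

theorem BipGraph.length_encode (G : BipGraph) :
    G.encode.length = G.m + G.n + G.encodeRows.length + 2 := by
  simp [encode_eq]
  omega

theorem CountingProblem.length_encodeWithNat (P : CountingProblem) (p : P.Inst × ℕ) :
    (P.encodeWithNat p).length = (P.encode p.1).length + (Nat.bits p.2).length := by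
  simp [encodeWithNat]

theorem kMatchingProblem_polyReducible (c α : ℝ) :
    (kMatchingProblem c α).PolyReducible perfectMatchingProblem := by
  refine ⟨fun x => ⟨x.1.1.pad x.1.2, ?_⟩,
    fun y => y.2 / ((y.1.1.1.n - y.1.1.2).factorial * (y.1.1.1.m - y.1.1.2).factorial),
    ?_, ?_, fun x => ?_⟩
  · have := x.2.1
    change x.1.1.m + (x.1.1.n - x.1.2) = x.1.1.n + (x.1.1.m - x.1.2)
    omega
  · refine polyTime_of_exec (α := Option Bool) (β := Option Bool) padGraph
      (Polynomial.C 100 * Polynomial.X ^ 2) ?_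
    rintro ⟨⟨G, k⟩, hk, -⟩
    obtain ⟨hm, hn⟩ := le_min_iff.1 hk
    refine (Exec.padGraph hm hn G.encodeRows).weaken ?_ ?_
    · change _ = Mem.mk _ (G.pad k).encode _ _ _
      rw [BipGraph.encode_pad]
    · simp only [Polynomial.eval_mul, Polynomial.eval_C, Polynomial.eval_pow, Polynomial.eval_X]
      gcongr
      simp only [kMatchingProblem, List.length_append, List.length_replicate, List.length_cons,
        BipGraph.length_encode]
      omega
  · refine polyTime_of_exec (α := Option Bool ⊕ Bool) (β := Bool) unpad
      (Polynomial.C 100 * Polynomial.X ^ 3) ?_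
    rintro ⟨⟨⟨G, k⟩, hk, -⟩, N⟩
    obtain ⟨hm, hn⟩ := le_min_iff.1 hk
    refine (Exec.unpad hm hn G.encodeRows N).weaken rfl ?_
    simp only [Polynomial.eval_mul, Polynomial.eval_C, Polynomial.eval_pow, Polynomial.eval_X]
    gcongr
    refine le_of_le_of_eq ?_
      (CountingProblem.length_encodeWithNat (kMatchingProblem c α) _).symm
    simp only [kMatchingProblem, List.length_append, List.length_replicate, List.length_cons,
      BipGraph.length_encode]
    omega
  · obtain ⟨hm, hn⟩ := le_min_iff.1 x.2.1
    refine (Nat.div_eq_of_eq_mul_left (by positivity) ?_).symm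
    exact BipGraph.numMatchings_pad x.1.1 hm hn

theorem perfectMatchingProblem_polyReducible {c α : ℝ} (hc : c ∈ Set.Ioc (0 : ℝ) 1)
    (hα : α ∈ Set.Ioc (0 : ℝ) 1) :
    perfectMatchingProblem.PolyReducible (kMatchingProblem c α) := by
  refine ⟨fun G => ⟨(G.1, G.1.n), ?_, ?_⟩, fun y => y.2, ?_, ?_, fun x => rfl⟩
  · simp [G.2]
  · have h : (G.1.n : ℝ) ^ α ≤ G.1.n := by
      rcases Nat.eq_zero_or_pos G.1.n with h | h
      · simp [h, Real.zero_rpow hα.1.ne']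
      · have h1 : (1 : ℝ) ≤ G.1.n := by exact_mod_cast h
        exact (Real.rpow_le_rpow_of_exponent_le h1 hα.2).trans_eq (Real.rpow_one _)
    simp only [G.2, max_self]
    calc c * (G.1.n : ℝ) ^ α ≤ 1 * G.1.n := by gcongr; exact hc.2
      _ = G.1.n := one_mul _
  · refine polyTime_of_exec (α := Option Bool) (β := Option Bool) dupBlock
      (Polynomial.C 20 * Polynomial.X) ?_
    rintro ⟨⟨m, n, E⟩, rfl : m = n⟩
    refine (Exec.dupBlock m (List.replicate m (some true) ++ none ::
      BipGraph.encodeRows ⟨m, m, E⟩)).weaken rfl ?_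
    simp only [Polynomial.eval_mul, Polynomial.eval_C, Polynomial.eval_X]
    gcongr
    simp only [perfectMatchingProblem, List.length_append, List.length_replicate, List.length_cons,
      BipGraph.length_encode]
    omega
  · refine polyTime_of_exec (α := Option Bool ⊕ Bool) (β := Bool) projNat
      (Polynomial.C 4 * Polynomial.X + 2) ?_
    rintro ⟨G, N⟩
    refine (Exec.projNat (perfectMatchingProblem.encode G) (Nat.bits N)).weaken rfl ?_
    simp only [Polynomial.eval_add, Polynomial.eval_mul, Polynomial.eval_C, Polynomial.eval_X,
      Polynomial.eval_ofNat]
    gcongr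
    exact (CountingProblem.length_encodeWithNat perfectMatchingProblem (G, N)).ge

/-- As `max #V₁ #V₂ ≤ (k / c) ^ (1 / α)`, the input length is polynomial in `k`; the exponent
`1 / α` and the factor `1 / c` are rounded up to natural numbers. -/
theorem exists_length_encode_le {c α : ℝ} (hc : 0 < c) (hα : 0 < α) :
    ∃ p : Polynomial ℕ, ∀ x : (kMatchingProblem c α).Inst,
      ((kMatchingProblem c α).encode x).length ≤ p.eval x.1.2 := by
  obtain ⟨C, hC⟩ := exists_nat_ge c⁻¹
  obtain ⟨D, hD⟩ := exists_nat_ge α⁻¹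
  have key : ∀ N k : ℕ, c * (N : ℝ) ^ α ≤ k → N ≤ (C * k) ^ D := by
    intro N k h
    rcases Nat.eq_zero_or_pos N with rfl | hN
    · exact Nat.zero_le _
    have hN' : (1 : ℝ) ≤ N := by exact_mod_cast hN
    have h1 : (N : ℝ) ^ α ≤ (C * k : ℕ) := by
      push_cast
      calc (N : ℝ) ^ α = c⁻¹ * (c * (N : ℝ) ^ α) := by field_simp
        _ ≤ C * k := by gcongr
    have h2 : (1 : ℝ) ≤ (C * k : ℕ) := (Real.one_le_rpow hN' hα.le).trans h1
    have h3 : (N : ℝ) ≤ (((C * k) ^ D : ℕ) : ℝ) := by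
      calc (N : ℝ) = ((N : ℝ) ^ α) ^ α⁻¹ := (Real.rpow_rpow_inv (by positivity) hα.ne').symm
        _ ≤ ((C * k : ℕ) : ℝ) ^ α⁻¹ := by gcongr
        _ ≤ ((C * k : ℕ) : ℝ) ^ (D : ℝ) := Real.rpow_le_rpow_of_exponent_le h2 hD
        _ = (((C * k) ^ D : ℕ) : ℝ) := by rw [Real.rpow_natCast]; push_cast; rfl
    exact_mod_cast h3
  refine ⟨Polynomial.X + 3 + 3 * (Polynomial.C C * Polynomial.X) ^ D +
    ((Polynomial.C C * Polynomial.X) ^ D) ^ 2, ?_⟩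
  rintro ⟨⟨G, k⟩, -, hk⟩
  have h := key _ _ hk
  have hm : G.m ≤ (C * k) ^ D := (le_max_left _ _).trans h
  have hn : G.n ≤ (C * k) ^ D := (le_max_right _ _).trans h
  simp only [kMatchingProblem, List.length_append, List.length_replicate, List.length_cons,
    BipGraph.length_encode, BipGraph.length_encodeRows, Polynomial.eval_add, Polynomial.eval_mul,
    Polynomial.eval_C, Polynomial.eval_pow, Polynomial.eval_X, Polynomial.eval_ofNat]
  generalize (C * k) ^ D = M at hm hn
  have : G.m * (G.n + 1) ≤ M * (M + 1) := by gcongr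
  linarith

theorem proposition2p2 (c α : ℝ) (hc : c ∈ Set.Ioc (0 : ℝ) 1) (hα : α ∈ Set.Ioc (0 : ℝ) 1) :
    (kMatchingProblem c α).PolyEquivalent perfectMatchingProblem ∧
    ∃ p : Polynomial ℕ, ∀ x : (kMatchingProblem c α).Inst,
      ((kMatchingProblem c α).encode x).length ≤ p.eval x.1.2 :=
  ⟨⟨kMatchingProblem_polyReducible c α, perfectMatchingProblem_polyReducible hc hα⟩,
    exists_length_encode_le hc.1 hα.1⟩
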